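/- Setting. Let $n,m\ge 1$, let $f_{i,j}:\mathbb{R}^p\to\mathbb{R}$ ($1\le i\le n$, $1\le j\le m$) be differentiable with $\|\nabla f_{i,j}(x)-\nabla f_{i,j}(y)\|\le L\|x-y\|$ for all $x,y$ and some $L>0$, put $f_i=\frac1m\sum_{j=1}^m f_{i,j}$, $F=\frac1n\sum_{i=1}^n f_i$, and assume $F^*:=\inf F>-\infty$ and the Polyak–Łojasiewicz condition $2\mu(F(x)-F^*)\le\|\nabla F(x)\|^2$ for all $x\in\mathbb{R}^p$, with $\mu>0$. Let $\kappa:=L/\mu\ge 1$ (which is automatic unless $F$ is constant). Let $W=(w_{ir})\in\mathbb{R}^{n\times n}$ be primitive and doubly stochastic, with second largest singular value $\lambda\in[0,1)$ ($\lambda:=0$ if $n=1$). GT-SAGA with step size $\alpha>0$ starts at $x_i^0=z_{i,j}^0=\overline{x}^0\in\mathbb{R}^p$ (deterministic, the same for all $i,j$), $y_i^0=g_i^{-1}=0$, and for $k\ge 0$ and every node $i$ performs $$g_i^k=\nabla f_{i,\tau_i^k}(x_i^k)-\nabla f_{i,\tau_i^k}(z_{i,\tau_i^k}^k)+\frac1m\sum_{j=1}^m\nabla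 f_{i,j}(z_{i,j}^k),$$ $$y_i^{k+1}=\sum_{r=1}^n w_{ir}(y_r^k+g_r^k-g_r^{k-1}),\qquad x_i^{k+1}=\sum_{r=1}^n w_{ir}(x_r^k-\alpha y_r^{k+1}),$$ $z_{i,j}^{k+1}=x_i^k$ for $j=s_i^k$ and $z_{i,j}^{k+1}=z_{i,j}^k$ for $j\ne s_i^k$, where all the indices $\tau_i^k,s_i^k$ are independent and uniform on $\{1,\dots,m\}$. Let $$\overline\alpha_2:=\min\Big\{\frac{(1-\lambda^2)^2}{55\lambda L},\frac{1-\lambda^2}{13\lambda\kappa^{1/4}L},\frac{(1-\lambda^2)^3}{388\lambda^2nL},\frac{n^{1/3}}{10.5\,m^{2/3}\kappa^{1/3}L},\frac1{36L},\frac{1-\lambda^2}{2\mu},\frac1{4m\mu}\Big\},$$ where the first three terms are $+\infty$ if $\lambda=0$. Theorem. (a) If $0<\alpha\le\overline\alpha_2$, then all nodes converge linearly to a global minimizer of $F$: there are a constant $C$, independent of $k$, and a random vector $x^*$, almost surely a global minimizer of $F$, such that for all $k\ge0$ and all $i$ $$\mathbb{E}\Big[\frac1n\sum_{r=1}^n\big(F(x_r^k)-F^*\big)\Big]\le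 C\Big(1-\frac{\mu\alpha}2\Big)^k,\qquad \mathbb{E}\big[\|x_i^k-x^*\|^2\big]\le C\Big(1-\frac{\mu\alpha}2\Big)^k.$$ (b) If $\alpha=\overline\alpha_2$, then all nodes agree on an $\epsilon$-accurate global minimizer in $\mathcal{O}(\max\{Q_{\mathrm{opt}},Q_{\mathrm{net}}\}\log\frac1\epsilon)$ iterations, where $$Q_{\mathrm{opt}}=\max\Big\{\frac{m^{2/3}\kappa^{4/3}}{n^{1/3}},\kappa,m\Big\},\qquad Q_{\mathrm{net}}=\max\Big\{\frac{\lambda\kappa}{(1-\lambda)^2},\frac{\lambda\kappa^{5/4}}{1-\lambda},\frac{\lambda^2n\kappa}{(1-\lambda)^3},\frac1{1-\lambda}\Big\}.$$ That is, there is a universal constant $c>0$ such that, for all $\epsilon>0$ small enough (depending on the problem instance), there is an integer $K\le c\max\{Q_{\mathrm{opt}},Q_{\mathrm{net}}\}\log\frac1\epsilon$ with $\mathbb{E}[\frac1n\sum_i(F(x_i^k)-F^*)]\le\epsilon$ and $\mathbb{E}[\|x_i^k-x_r^k\|^2]\le\epsilon$ for all $k\ge K$ and all $i,r$. (c) If $\lambda=0$,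 then for every $\alpha$ and along every sequence of sampled indices all the $x_i^k$ coincide with the iterates of the original (unrestarted) centralized minibatch SAGA, which is plain SAGA for $n=1$, and $\max\{Q_{\mathrm{opt}},Q_{\mathrm{net}}\}=Q_{\mathrm{opt}}$. -/

import Mathlib

open MeasureTheory ProbabilityTheory

namespace GTSAGA

noncomputable section

/-- The decision space `ℝ^p` with its Euclidean norm. -/
abbrev Vec (p : ℕ) : Type := EuclideanSpace ℝ (Fin p)

/-- The global objective `F = (1/n) ∑ᵢ fᵢ`, where `fᵢ = (1/m) ∑ⱼ fᵢⱼ`. -/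
def globalF {n m p : ℕ} (f : Fin n → Fin m → Vec p → ℝ) (x : Vec p) : ℝ :=
  (1 / (n : ℝ)) * ∑ i, (1 / (m : ℝ)) * ∑ j, f i j x

/-- The optimal value `F* = inf F`; it is only used when `F` is bounded below. -/
def optVal {n m p : ℕ} (f : Fin n → Fin m → Vec p → ℝ) : ℝ := ⨅ x, globalF f x

/-- Every component is differentiable and `L`-smooth, and `F` is bounded below. -/
structure IsSmooth {n m p : ℕ} (f : Fin n → Fin m → Vec p → ℝ) (L : ℝ) : Prop where
  L_pos : 0 < L
  differentiable : ∀ i j, Differentiable ℝ (f i j)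
  lipschitz_gradient : ∀ i j x y, ‖gradient (f i j) x - gradient (f i j) y‖ ≤ L * ‖x - y‖
  bddBelow : BddBelow (Set.range (globalF f))

/-- The global Polyak-Łojasiewicz condition with parameter `μ`. -/
structure IsPL {n m p : ℕ} (f : Fin n → Fin m → Vec p → ℝ) (μ : ℝ) : Prop where
  mu_pos : 0 < μ
  ineq : ∀ x, 2 * μ * (globalF f x - optVal f) ≤ ‖gradient (globalF f) x‖ ^ 2

/-- The second largest singular value of `W`. Singular values are numbered from `0` in decreasing
order and padded with zeros, so this is `0` for a single node. -/
def secondSV {n : ℕ} (W : Matrix (Fin n) (Fin n) ℝ) : ℝ :=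
  (Matrix.toEuclideanLin W).singularValues 1

/-- Primitive, doubly stochastic, second largest singular value in `[0, 1)`. -/
structure IsWeight {n : ℕ} (W : Matrix (Fin n) (Fin n) ℝ) : Prop where
  primitive : W.IsPrimitive
  doublyStochastic : W ∈ doublyStochastic ℝ (Fin n)
  secondSV_lt_one : secondSV W < 1

/-- The sampled indices `τ k i`, `s k i` are uniform on the `m` indices and the whole family
(both kinds together, over all iterations and nodes) is independent. -/
structure IsSampling {n m : ℕ} {Ω : Type*} [MeasurableSpace Ω] (P : Measure Ω)
    (τ s : ℕ → Fin n → Ω → Fin m) : Prop where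
  measurable_tau : ∀ k i, Measurable (τ k i)
  measurable_s : ∀ k i, Measurable (s k i)
  uniform_tau : ∀ k i j, P.real {ω | τ k i ω = j} = 1 / (m : ℝ)
  uniform_s : ∀ k i j, P.real {ω | s k i ω = j} = 1 / (m : ℝ)
  indep : iIndepFun (fun q : (ℕ × Fin n) ⊕ (ℕ × Fin n) =>
    Sum.elim (fun a => τ a.1 a.2) (fun a => s a.1 a.2) q) P

/-- The local SAGA gradient estimator at a node with components `φ`, gradient table points `z`,
current point `x` and sampled index `t`. -/
def sagaEstimator {m p : ℕ} (φ : Fin m → Vec p → ℝ) (x : Vec p) (z : Fin m → Vec p)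
    (t : Fin m) : Vec p :=
  gradient (φ t) x - gradient (φ t) (z t) + (1 / (m : ℝ)) • ∑ j, gradient (φ j) (z j)

/-- All the variables of the network at the start of an iteration `k`: the points `xᵢ`, the
trackers `yᵢ`, the table points `zᵢⱼ`, and the estimators `gᵢ` of iteration `k - 1`. -/
structure NetState (n m p : ℕ) where
  x : Fin n → Vec p
  y : Fin n → Vec p
  z : Fin n → Fin m → Vec p
  g : Fin n → Vec p

/-- One iteration of GT-SAGA, with sampled indices `t i` and `r i`. -/
def netStep {n m p : ℕ} (f : Fin n → Fin m → Vec p → ℝ) (W : Matrix (Fin n) (Fin n) ℝ) (α : ℝ)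
    (t r : Fin n → Fin m) (S : NetState n m p) : NetState n m p :=
  let g : Fin n → Vec p := fun i => sagaEstimator (f i) (S.x i) (S.z i) (t i)
  let y : Fin n → Vec p := fun i => ∑ l, W i l • (S.y l + g l - S.g l)
  { x := fun i => ∑ l, W i l • (S.x l - α • y l)
    y := y
    z := fun i j => if j = r i then S.x i else S.z i j
    g := g }

/-- The run of GT-SAGA from the common initial point `x0`, along given sampled indices. -/
def netState {n m p : ℕ} (f : Fin n → Fin m → Vec p → ℝ) (W : Matrix (Fin n) (Fin n) ℝ) (α : ℝ)
    (x0 : Vec p) (t r : ℕ → Fin n → Fin m) : ℕ → NetState n m p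
  | 0 => { x := fun _ => x0, y := fun _ => 0, z := fun _ _ => x0, g := fun _ => 0 }
  | k + 1 => netStep f W α (t k) (r k) (netState f W α x0 t r k)

/-- The random iterate `xᵢᵏ` of node `i` at iteration `k`. -/
def iter {n m p : ℕ} {Ω : Type*} (f : Fin n → Fin m → Vec p → ℝ)
    (W : Matrix (Fin n) (Fin n) ℝ) (α : ℝ) (x0 : Vec p) (τ s : ℕ → Fin n → Ω → Fin m)
    (k : ℕ) (i : Fin n) (ω : Ω) : Vec p :=
  (netState f W α x0 (fun k i => τ k i ω) (fun k i => s k i ω) k).x i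

/-- The average optimality gap `(1/n) ∑ᵢ (F(xᵢᵏ) - F*)`. -/
def gap {n m p : ℕ} {Ω : Type*} (f : Fin n → Fin m → Vec p → ℝ)
    (W : Matrix (Fin n) (Fin n) ℝ) (α : ℝ) (x0 : Vec p) (τ s : ℕ → Fin n → Ω → Fin m)
    (k : ℕ) (ω : Ω) : ℝ :=
  (1 / (n : ℝ)) * ∑ i, (globalF f (iter f W α x0 τ s k i ω) - optVal f)

/-- Centralized (minibatch) SAGA, without restarts, on all `n * m` components, with one index
sampled from each of the `n` batches per iteration: the pair of the point and the table points.
For `n = 1` this is plain SAGA. -/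
def centralSAGA {n m p : ℕ} (f : Fin n → Fin m → Vec p → ℝ) (α : ℝ)
    (x0 : Vec p) (t r : ℕ → Fin n → Fin m) : ℕ → Vec p × (Fin n → Fin m → Vec p)
  | 0 => (x0, fun _ _ => x0)
  | k + 1 =>
    let S := centralSAGA f α x0 t r k
    (S.1 - α • ((1 / (n : ℝ)) • ∑ i, sagaEstimator (f i) S.1 (S.2 i) (t k i)),
      fun i j => if j = r k i then S.1 else S.2 i j)

/-- The step-size bound `ᾱ₂`. The three terms with `lam` in the denominator are `+∞` for
`lam = 0`, so they are absent from the minimum in that case. -/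
def alphaBar (n m : ℕ) (L μ lam : ℝ) : ℝ :=
  let b : ℝ :=
    min (min ((n : ℝ) ^ (1 / 3 : ℝ) / (10.5 * (m : ℝ) ^ (2 / 3 : ℝ) * (L / μ) ^ (1 / 3 : ℝ) * L))
        (1 / (36 * L)))
      (min ((1 - lam ^ 2) / (2 * μ)) (1 / (4 * m * μ)))
  if lam = 0 then b
  else
    min (min ((1 - lam ^ 2) ^ 2 / (55 * lam * L))
        ((1 - lam ^ 2) / (13 * lam * (L / μ) ^ (1 / 4 : ℝ) * L)))
      (min ((1 - lam ^ 2) ^ 3 / (388 * lam ^ 2 * n * L)) b)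

/-- `Q_opt = max {m^{2/3} κ^{4/3} / n^{1/3}, κ, m}`. -/
def Qopt (n m : ℕ) (κ : ℝ) : ℝ :=
  max ((m : ℝ) ^ (2 / 3 : ℝ) * κ ^ (4 / 3 : ℝ) / (n : ℝ) ^ (1 / 3 : ℝ)) (max κ m)

/-- `Q_net = max {λκ/(1-λ)², λκ^{5/4}/(1-λ), λ²nκ/(1-λ)³, 1/(1-λ)}`. -/
def Qnet (n : ℕ) (κ lam : ℝ) : ℝ :=
  max (max (lam * κ / (1 - lam) ^ 2) (lam * κ ^ (5 / 4 : ℝ) / (1 - lam)))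
    (max (lam ^ 2 * n * κ / (1 - lam) ^ 3) (1 / (1 - lam)))

end

end GTSAGA

/-! The proof is a Lyapunov argument. From a fixed state, one iteration is averaged over the
independent uniform indices (`stepMean`), and four errors are followed: the optimality gap at the
average point, the consensus error, the distance of the table points to the average point, and the
consensus error of the trackers. The last is measured on `track`, the tracker with the coming noise
removed. It is a function of the current state, and the noise enters the next state through additive
terms with conditional mean zero, so most cross terms vanish.

Averages survive mixing, and the trackers always have the same average as the estimators
(`Tracking`). The average point therefore makes an inexact gradient step whose noise variance is
divided by `n`. Smoothness and the PL inequality contract the gap and leave a negative multiple of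
the squared norm of the mean local gradient (`stepMean_gapErr_le`). On vectors of zero average `W`
contracts by its second singular value (`msq_mix_le`), which contracts the consensus and tracking
errors (`stepMean_consErr_le`, `stepMean_trackErr_le`). Table points are refreshed with probability
`1 / m` (`stepMean_tableErr_le`). The noise variance is bounded by the consensus and table errors
(`noiseVar_le`), so it vanishes at the limit and a constant step suffices.

For small steps a weighted sum of the four errors absorbs every coupling (`exists_weights`) and
contracts by `1 - μ * α / 2` (`exists_stepMean_lyapunov_le`). Independence turns this into geometric
decay of expectations (`integral_run_succ`, `exists_errors_le`). The increments of the average point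
then decay geometrically in mean square, so it converges almost surely; the vanishing expected gap
makes the limit a minimizer, and the consensus error brings the nodes along (`exists_minimizer`).
The complexity follows by comparing each term of the step bound with the matching term of `Qopt` or
`Qnet` (`one_div_mul_alphaBar_le`). If the second singular value is zero, mixing is exact averaging
(`netState_eq_centralSAGA`). -/

namespace GTSAGA

noncomputable section

set_option linter.unusedSectionVars false

/-! ### Averages and mean squares of finite families -/

/-- The uniform average of a finite family. -/
def mean {ι E : Type*} [Fintype ι] [AddCommGroup E] [Module ℝ E] (u : ι → E) : E :=
  (Fintype.card ι : ℝ)⁻¹ • ∑ i, u i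

section Mean

variable {ι κ E : Type*} [Fintype ι] [Fintype κ] [AddCommGroup E] [Module ℝ E]

theorem mean_add (u v : ι → E) : mean (fun i => u i + v i) = mean u + mean v := by
  simp [mean, Finset.sum_add_distrib]

theorem mean_sub (u v : ι → E) : mean (fun i => u i - v i) = mean u - mean v := by
  simp [mean, Finset.sum_sub_distrib, smul_sub]

theorem mean_smul (c : ℝ) (u : ι → E) : mean (fun i => c • u i) = c • mean u := by
  simp only [mean, ← Finset.smul_sum, smul_comm c]

theorem mean_mul (c : ℝ) (u : ι → ℝ) : mean (fun i => c * u i) = c * mean u :=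
  mean_smul c u

theorem mean_sum {σ : Type*} (s : Finset σ) (u : σ → ι → E) :
    mean (fun i => ∑ a ∈ s, u a i) = ∑ a ∈ s, mean (u a) := by
  simp only [mean]
  rw [Finset.sum_comm, Finset.smul_sum]

theorem card_smul_mean [Nonempty ι] (u : ι → E) :
    (Fintype.card ι : ℝ) • mean u = ∑ i, u i := by
  rw [mean, smul_inv_smul₀]
  exact_mod_cast Fintype.card_ne_zero

theorem mean_const [Nonempty ι] (c : E) : mean (fun _ : ι => c) = c := by
  rw [mean, Finset.sum_const, Finset.card_univ, ← Nat.cast_smul_eq_nsmul ℝ, inv_smul_smul₀]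
  exact_mod_cast Fintype.card_ne_zero

theorem mean_comm (u : ι → κ → E) :
    mean (fun i => mean (fun j => u i j)) = mean (fun j => mean (fun i => u i j)) := by
  simp only [mean, ← Finset.smul_sum]
  rw [smul_comm, Finset.sum_comm]

theorem mean_nonneg {u : ι → ℝ} (h : ∀ i, 0 ≤ u i) : 0 ≤ mean u :=
  mul_nonneg (by positivity) (Finset.sum_nonneg fun i _ => h i)

theorem mean_mono {u v : ι → ℝ} (h : ∀ i, u i ≤ v i) : mean u ≤ mean v :=
  mul_le_mul_of_nonneg_left (Finset.sum_le_sum fun i _ => h i) (by positivity)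

theorem mean_sub_mean [Nonempty ι] (u : ι → E) : mean (fun i => u i - mean u) = 0 := by
  rw [mean_sub, mean_const, sub_self]

end Mean

/-- The mean square norm of a finite family. -/
def msq {ι E : Type*} [Fintype ι] [NormedAddCommGroup E] (u : ι → E) : ℝ :=
  mean fun i => ‖u i‖ ^ 2

section Square

variable {ι E : Type*} [Fintype ι] [NormedAddCommGroup E]

theorem msq_nonneg (u : ι → E) : 0 ≤ msq u := mean_nonneg fun _ => sq_nonneg _

theorem norm_add_sq_le_young (a b : E) {η : ℝ} (hη : 0 < η) :
    ‖a + b‖ ^ 2 ≤ (1 + η) * ‖a‖ ^ 2 + (1 + 1 / η) * ‖b‖ ^ 2 := by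
  have h1 : ‖a + b‖ ^ 2 ≤ (‖a‖ + ‖b‖) ^ 2 := by gcongr; exact norm_add_le a b
  have h2 : 0 ≤ (η * ‖a‖ - ‖b‖) ^ 2 / η := by positivity
  have h3 : (η * ‖a‖ - ‖b‖) ^ 2 / η = η * ‖a‖ ^ 2 - 2 * ‖a‖ * ‖b‖ + 1 / η * ‖b‖ ^ 2 := by
    field_simp
    ring
  nlinarith

theorem msq_add_le_young (u v : ι → E) {η : ℝ} (hη : 0 < η) :
    msq (fun i => u i + v i) ≤ (1 + η) * msq u + (1 + 1 / η) * msq v := by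
  simp only [msq]
  rw [← mean_mul, ← mean_mul, ← mean_add]
  exact mean_mono fun i => norm_add_sq_le_young _ _ hη

theorem msq_add_le (u v : ι → E) : msq (fun i => u i + v i) ≤ 2 * msq u + 2 * msq v := by
  have := msq_add_le_young u v one_pos
  norm_num at this
  exact this

theorem norm_sq_le_card_mul_msq [Nonempty ι] (u : ι → E) (i : ι) :
    ‖u i‖ ^ 2 ≤ Fintype.card ι * msq u := by
  have h := card_smul_mean fun i => ‖u i‖ ^ 2
  rw [smul_eq_mul] at h
  rw [msq, h]
  exact Finset.single_le_sum (f := fun i => ‖u i‖ ^ 2) (fun _ _ => sq_nonneg _) (Finset.mem_univ i)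

variable [InnerProductSpace ℝ E]

theorem mean_inner (c : E) (u : ι → E) :
    mean (fun i => inner ℝ c (u i)) = inner ℝ c (mean u) := by
  simp [mean, inner_smul_right, inner_sum]

theorem msq_const_add [Nonempty ι] (c : E) {u : ι → E} (hu : mean u = 0) :
    msq (fun i => c + u i) = ‖c‖ ^ 2 + msq u := by
  have h : ∀ i, ‖c + u i‖ ^ 2 = (‖c‖ ^ 2 + 2 * inner ℝ c (u i)) + ‖u i‖ ^ 2 := fun i =>
    norm_add_sq_real c (u i)
  simp only [msq, h]
  rw [mean_add, mean_add, mean_const, mean_mul, mean_inner, hu]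
  simp

theorem msq_eq_add_msq_sub_mean [Nonempty ι] (u : ι → E) :
    msq u = ‖mean u‖ ^ 2 + msq (fun i => u i - mean u) := by
  rw [← msq_const_add _ (mean_sub_mean u)]
  simp

theorem msq_sub_mean_le [Nonempty ι] (u : ι → E) : msq (fun i => u i - mean u) ≤ msq u := by
  rw [msq_eq_add_msq_sub_mean u]
  nlinarith [sq_nonneg ‖mean u‖]

theorem norm_mean_sq_le [Nonempty ι] (u : ι → E) : ‖mean u‖ ^ 2 ≤ msq u := by
  rw [msq_eq_add_msq_sub_mean u]
  nlinarith [msq_nonneg (fun i => u i - mean u)]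

theorem msq_smul (c : ℝ) (u : ι → E) : msq (fun i => c • u i) = c ^ 2 * msq u := by
  simp [msq, norm_smul, mul_pow, mean_mul]

theorem msq_sub_le (u v : ι → E) : msq (fun i => u i - v i) ≤ 2 * msq u + 2 * msq v := by
  have h := msq_add_le u (fun i => (-1 : ℝ) • v i)
  rw [msq_smul] at h
  simpa [sub_eq_add_neg] using h

end Square

/-! ### Averages over independent uniform indices -/

section Product

variable {ι κ E : Type*} [Fintype ι] [DecidableEq ι] [Fintype κ]

/-- Resampling one coordinate preserves the uniform law: exchanging the new value with the old one
is an involution on pairs. -/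
theorem mean_pi_update [Nonempty κ] [AddCommGroup E] [Module ℝ E] (F : (ι → κ) → E) (i : ι) :
    mean (fun t : ι → κ => mean fun j => F (Function.update t i j)) = mean F := by
  have h : ∑ t : ι → κ, ∑ j, F (Function.update t i j) = ∑ t : ι → κ, ∑ _j : κ, F t := by
    rw [← Fintype.sum_prod_type', ← Fintype.sum_prod_type']
    refine Finset.sum_nbij' (fun q => (Function.update q.1 i q.2, q.1 i))
      (fun q => (Function.update q.1 i q.2, q.1 i)) ?_ ?_ ?_ ?_ ?_ <;> simp
  have h2 : mean (fun t : ι → κ => mean fun j => F (Function.update t i j)) =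
      mean (fun t : ι → κ => mean fun _ : κ => F t) := by
    simp only [mean, ← Finset.smul_sum, h]
  rw [h2]
  simp only [mean_const]

theorem mean_pi_apply [Nonempty κ] [AddCommGroup E] [Module ℝ E] (h : κ → E) (i : ι) :
    mean (fun t : ι → κ => h (t i)) = mean h := by
  rw [← mean_pi_update _ i]
  simp only [Function.update_self, mean_const]

/-- Variances of independent centred vectors add: for two different nodes, averaging one index first
kills the inner product. -/
theorem mean_norm_sum_sq [Nonempty κ] [NormedAddCommGroup E] [InnerProductSpace ℝ E]
    (v : ι → κ → E) (hv : ∀ i, mean (v i) = 0) :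
    mean (fun t : ι → κ => ‖∑ i, v i (t i)‖ ^ 2) = ∑ i, msq (v i) := by
  have h : ∀ t : ι → κ, ‖∑ i, v i (t i)‖ ^ 2 = ∑ i, ∑ l, inner ℝ (v i (t i)) (v l (t l)) := by
    intro t
    rw [← real_inner_self_eq_norm_sq, sum_inner]
    simp only [inner_sum]
  simp only [h, mean_sum]
  refine Finset.sum_congr rfl fun i _ => ?_
  rw [Finset.sum_eq_single i]
  · rw [mean_pi_apply (fun j => inner ℝ (v i j) (v i j)) i]
    simp [msq]
  · intro l _ hl
    rw [← mean_pi_update _ l]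
    simp only [Function.update_self, Function.update_of_ne hl.symm, mean_inner, hv,
      inner_zero_right, mean_const]
  · simp

end Product

/-! ### Spectral contraction of the weight matrix -/

theorem secondSV_nonneg {n : ℕ} (W : Matrix (Fin n) (Fin n) ℝ) : 0 ≤ secondSV W :=
  LinearMap.singularValues_nonneg _ _

/-- The all-ones vector is fixed by `W` and its transpose, hence by `S = TᵀT`. Eigenvalues of `S`
after the first are below one, so their eigenvectors are orthogonal to it. It thus spans the first
eigendirection, in which `v` has no component. -/
theorem norm_toEuclideanLin_sq_le {n : ℕ} {W : Matrix (Fin n) (Fin n) ℝ} (hW : IsWeight W)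
    (v : EuclideanSpace ℝ (Fin n)) (hv : ∑ i, v i = 0) :
    ‖Matrix.toEuclideanLin W v‖ ^ 2 ≤ secondSV W ^ 2 * ‖v‖ ^ 2 := by
  set T := Matrix.toEuclideanLin W with hT
  set S := LinearMap.adjoint T ∘ₗ T with hS
  have hsym : S.IsSymmetric := T.isSymmetric_adjoint_comp_self
  have hfin : Module.finrank ℝ (EuclideanSpace ℝ (Fin n)) = n := by simp
  set b := hsym.eigenvectorBasis hfin with hb
  set ev := hsym.eigenvalues hfin with hev
  let e : EuclideanSpace ℝ (Fin n) := WithLp.toLp 2 fun _ => 1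
  obtain ⟨_, hrow, hcol⟩ := mem_doublyStochastic_iff_sum.1 hW.doublyStochastic
  have hTe : T e = e := by
    ext i
    simp [hT, Matrix.toLpLin_apply, Matrix.mulVec, dotProduct, e, hrow]
  have hTe' : LinearMap.adjoint T e = e := by
    rw [hT, ← Matrix.toEuclideanLin_conjTranspose_eq_adjoint]
    ext i
    simp [Matrix.toLpLin_apply, Matrix.mulVec, dotProduct, e, hcol]
  have hSe : S e = e := by simp [hS, hTe, hTe']
  have hev_le : ∀ i : Fin n, 0 < (i : ℕ) → ev i ≤ secondSV W ^ 2 := by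
    intro i hi
    have h1 : 1 < n := by omega
    have h2 := T.sq_singularValues_of_lt hfin h1
    rw [secondSV, h2]
    exact hsym.eigenvalues_antitone hfin (Fin.mk_le_of_le_val hi)
  have hlt : secondSV W ^ 2 < 1 := by
    have := hW.secondSV_lt_one
    have := secondSV_nonneg W
    nlinarith
  have hbe : ∀ i : Fin n, 0 < (i : ℕ) → inner ℝ (b i) e = 0 := by
    intro i hi
    have h1 : inner ℝ (S (b i)) e = inner ℝ (b i) (S e) := hsym _ _
    rw [hSe, hb, hsym.apply_eigenvectorBasis, ← hb] at h1
    simp only [RCLike.ofReal_real_eq_id, id_eq, inner_smul_left, conj_trivial] at h1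
    have h2 := hev_le i hi
    -- Eigenvectors of a symmetric map for different eigenvalues, here `ev i < 1` and `1`, are
    -- orthogonal.
    have h3 : (1 - ev i) * inner ℝ (b i) e = 0 := by
      rw [hev]; linarith
    rcases mul_eq_zero.1 h3 with h | h
    · linarith
    · exact h
  have hbv : ∀ i : Fin n, (i : ℕ) = 0 → inner ℝ (b i) v = 0 := by
    intro i hi
    have he : inner ℝ e v = 0 := by
      simp [e, PiLp.inner_apply, hv]
    have hne : ∀ j, j ≠ i → inner ℝ (b j) e = 0 := fun j hj =>
      hbe j (by have : (j : ℕ) ≠ i := fun h => hj (Fin.ext h)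
                omega)
    have h1 : inner ℝ e v = inner ℝ (b i) e * inner ℝ (b i) v := by
      rw [← b.sum_inner_mul_inner e v, Finset.sum_eq_single i]
      · rw [real_inner_comm]
      · intro j _ hj
        rw [real_inner_comm, hne j hj, zero_mul]
      · simp
    have h2 : inner ℝ (b i) e ≠ 0 := by
      intro h0
      have h3 : inner ℝ e e = 0 := by
        rw [← b.sum_inner_mul_inner e e]
        refine Finset.sum_eq_zero fun j _ => ?_
        by_cases hj : j = i
        · rw [hj, h0, mul_zero]
        · rw [hne j hj, mul_zero]
      have h4 : e i = 0 := by rw [inner_self_eq_zero.1 h3]; rfl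
      simp [e] at h4
    rw [he] at h1
    exact (mul_eq_zero.1 h1.symm).resolve_left h2
  have h1 : ‖T v‖ ^ 2 = inner ℝ (S v) v := by
    rw [← real_inner_self_eq_norm_sq, hS, LinearMap.comp_apply, LinearMap.adjoint_inner_left]
  rw [h1, ← b.sum_inner_mul_inner, ← real_inner_self_eq_norm_sq v, ← b.sum_inner_mul_inner v v,
    Finset.mul_sum]
  refine Finset.sum_le_sum fun i _ => ?_
  have h2 : inner ℝ (S v) (b i) = ev i * inner ℝ v (b i) := by
    rw [hsym v (b i), hb, hsym.apply_eigenvectorBasis]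
    simp [inner_smul_right, hev]
  rw [h2, real_inner_comm (b i) v]
  rcases Nat.eq_zero_or_pos (i : ℕ) with hi | hi
  · simp [hbv i hi]
  · have := hev_le i hi
    nlinarith [mul_self_nonneg (inner ℝ (b i) v)]

/-- Mixing of the vectors held by the nodes with the weights `W`. -/
def mix {n : ℕ} {E : Type*} [AddCommGroup E] [Module ℝ E] (W : Matrix (Fin n) (Fin n) ℝ)
    (u : Fin n → E) : Fin n → E :=
  fun i => ∑ l, W i l • u l

section Mix

variable {n : ℕ} {E : Type*} [AddCommGroup E] [Module ℝ E] {W : Matrix (Fin n) (Fin n) ℝ}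

theorem mix_add (u v : Fin n → E) : mix W (u + v) = mix W u + mix W v := by
  ext i; simp [mix, Finset.sum_add_distrib]

theorem mix_sub (u v : Fin n → E) : mix W (u - v) = mix W u - mix W v := by
  ext i; simp [mix, smul_sub, Finset.sum_sub_distrib]

theorem mix_smul (c : ℝ) (u : Fin n → E) : mix W (c • u) = c • mix W u := by
  ext i
  simp only [mix, Pi.smul_apply, Finset.smul_sum]
  exact Finset.sum_congr rfl fun l _ => smul_comm _ _ _

theorem mix_const (hW : IsWeight W) (c : E) : mix W (fun _ => c) = fun _ => c := by
  obtain ⟨_, hrow, _⟩ := mem_doublyStochastic_iff_sum.1 hW.doublyStochastic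
  ext i
  simp [mix, ← Finset.sum_smul, hrow]

theorem mean_mix (hW : IsWeight W) (u : Fin n → E) : mean (mix W u) = mean u := by
  obtain ⟨_, _, hcol⟩ := mem_doublyStochastic_iff_sum.1 hW.doublyStochastic
  simp only [mean, mix]
  rw [Finset.sum_comm]
  simp [← Finset.sum_smul, hcol]

end Mix

/-- Mixing acts on each coordinate of `ℝ^p` separately, so the scalar bound is summed over
coordinates. -/
theorem msq_mix_le {n p : ℕ} {W : Matrix (Fin n) (Fin n) ℝ} (hW : IsWeight W)
    (u : Fin n → Vec p) (hu : mean u = 0) : msq (mix W u) ≤ secondSV W ^ 2 * msq u := by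
  rcases Nat.eq_zero_or_pos n with rfl | hn
  · simp [msq, mean]
  have : Nonempty (Fin n) := ⟨⟨0, hn⟩⟩
  have hsum : ∑ i, u i = 0 := by rw [← card_smul_mean, hu, smul_zero]
  have key : ∀ c : Fin p, ∑ i, (mix W u i c) ^ 2 ≤ secondSV W ^ 2 * ∑ i, (u i c) ^ 2 := by
    intro c
    have h := norm_toEuclideanLin_sq_le hW (WithLp.toLp 2 fun i => u i c) (by
      have := congrArg (fun w : Vec p => w c) hsum
      simpa using this)
    simp only [EuclideanSpace.norm_sq_eq, Real.norm_eq_abs, sq_abs] at h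
    simpa [Matrix.toLpLin_apply, Matrix.mulVec, dotProduct, mix] using h
  have hs : ∀ w : Fin n → Vec p, ∑ i, ‖w i‖ ^ 2 = ∑ c, ∑ i, (w i c) ^ 2 := by
    intro w
    rw [Finset.sum_comm]
    simp [EuclideanSpace.norm_sq_eq]
  have h : ∑ i, ‖mix W u i‖ ^ 2 ≤ secondSV W ^ 2 * ∑ i, ‖u i‖ ^ 2 := by
    rw [hs, hs, Finset.mul_sum]
    exact Finset.sum_le_sum fun c _ => key c
  rw [msq, msq, ← mean_mul]
  simp only [mean, smul_eq_mul, ← Finset.mul_sum]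
  exact mul_le_mul_of_nonneg_left h (by positivity)

/-! ### Smoothness of the objectives -/

/-- `h` is differentiable with an `L`-Lipschitz gradient. -/
structure LSmooth {p : ℕ} (h : Vec p → ℝ) (L : ℝ) : Prop where
  differentiable : Differentiable ℝ h
  lipschitz_gradient : ∀ x y, ‖gradient h x - gradient h y‖ ≤ L * ‖x - y‖

/-- Along the segment, the difference of the two sides has a nonpositive derivative by the Lipschitz
bound and Cauchy-Schwarz. -/
theorem LSmooth.le_quadratic {p : ℕ} {h : Vec p → ℝ} {L : ℝ} (hh : LSmooth h L) (x v : Vec p) :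
    h (x + v) ≤ h x + inner ℝ (gradient h x) v + L / 2 * ‖v‖ ^ 2 := by
  let φ : ℝ → ℝ := fun t =>
    h (x + t • v) - t * inner ℝ (gradient h x) v - t ^ 2 * (L / 2 * ‖v‖ ^ 2)
  have hd : ∀ t, HasDerivAt φ (inner ℝ (gradient h (x + t • v)) v - inner ℝ (gradient h x) v -
      2 * t * (L / 2 * ‖v‖ ^ 2)) t := by
    intro t
    have hline : HasDerivAt (fun t : ℝ => x + t • v) v t := by
      simpa using ((hasDerivAt_id t).smul_const v).const_add x
    have h1 := ((hh.differentiable (x + t • v)).hasFDerivAt.comp_hasDerivAt t hline)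
    rw [← inner_gradient_left] at h1
    have h2 := (hasDerivAt_id t).mul_const (inner ℝ (gradient h x) v)
    have h3 := ((hasDerivAt_id t).pow 2).mul_const (L / 2 * ‖v‖ ^ 2)
    convert! (h1.sub h2).sub h3 using 1
    simp
  have hanti : AntitoneOn φ (Set.Icc 0 1) := by
    refine antitoneOn_of_deriv_nonpos (convex_Icc 0 1)
      (fun t _ => (hd t).continuousAt.continuousWithinAt)
      (fun t _ => (hd t).differentiableAt.differentiableWithinAt) fun t ht => ?_
    rw [interior_Icc] at ht
    rw [(hd t).deriv, ← inner_sub_left]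
    have h1 := real_inner_le_norm (gradient h (x + t • v) - gradient h x) v
    have h2 := hh.lipschitz_gradient (x + t • v) x
    rw [add_sub_cancel_left, norm_smul, Real.norm_of_nonneg ht.1.le] at h2
    nlinarith [norm_nonneg v, mul_le_mul_of_nonneg_right h2 (norm_nonneg v)]
  have := hanti (Set.left_mem_Icc.2 zero_le_one) (Set.right_mem_Icc.2 zero_le_one) zero_le_one
  simp only [φ, one_smul, zero_smul, add_zero] at this
  linarith

theorem LSmooth.mean {p : ℕ} {ι : Type*} [Fintype ι] [Nonempty ι] {h : ι → Vec p → ℝ} {L : ℝ}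
    (hh : ∀ i, LSmooth (h i) L) :
    LSmooth (fun x => mean fun i => h i x) L ∧
      ∀ x, gradient (fun x => GTSAGA.mean fun i => h i x) x =
        GTSAGA.mean fun i => gradient (h i) x := by
  have hg : ∀ x, HasGradientAt (fun x => GTSAGA.mean fun i => h i x)
      (GTSAGA.mean fun i => gradient (h i) x) x := by
    intro x
    rw [hasGradientAt_iff_hasFDerivAt]
    have h1 : ∀ i ∈ Finset.univ, HasFDerivAt (h i)
        (InnerProductSpace.toDual ℝ (Vec p) (gradient (h i) x)) x := fun i _ =>
      hasGradientAt_iff_hasFDerivAt.1 ((hh i).differentiable x).hasGradientAt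
    have h2 := (HasFDerivAt.fun_sum h1).const_mul (Fintype.card ι : ℝ)⁻¹
    simpa [GTSAGA.mean] using h2
  refine ⟨⟨fun x => (hg x).differentiableAt, fun x y => ?_⟩, fun x => (hg x).gradient⟩
  rw [(hg x).gradient, (hg y).gradient, ← mean_sub]
  have h1 : ‖GTSAGA.mean fun i => gradient (h i) x - gradient (h i) y‖ ≤
      GTSAGA.mean fun i => ‖gradient (h i) x - gradient (h i) y‖ := by
    simp only [GTSAGA.mean, norm_smul, norm_inv, Real.norm_natCast, smul_eq_mul]
    gcongr
    exact norm_sum_le _ _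
  refine h1.trans ((mean_mono fun i => (hh i).lipschitz_gradient x y).trans ?_)
  rw [mean_const]

/-- The local objective `fᵢ`. -/
def localF {m p : ℕ} (φ : Fin m → Vec p → ℝ) (x : Vec p) : ℝ := mean fun j => φ j x

theorem globalF_eq {n m p : ℕ} (f : Fin n → Fin m → Vec p → ℝ) :
    globalF f = fun x => mean fun i => localF (f i) x := by
  ext x
  simp [globalF, mean, localF]

section Objective

variable {n m p : ℕ} {f : Fin n → Fin m → Vec p → ℝ} {L : ℝ}

theorem IsSmooth.lsmooth (hf : IsSmooth f L) (i : Fin n) (j : Fin m) : LSmooth (f i j) L :=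
  ⟨hf.differentiable i j, hf.lipschitz_gradient i j⟩

theorem IsSmooth.optVal_le (hf : IsSmooth f L) (x : Vec p) : optVal f ≤ GTSAGA.globalF f x :=
  ciInf_le hf.bddBelow x

variable [NeZero m]

theorem IsSmooth.localF (hf : IsSmooth f L) (i : Fin n) : LSmooth (localF (f i)) L :=
  (LSmooth.mean (hf.lsmooth i)).1

theorem IsSmooth.gradient_localF (hf : IsSmooth f L) (i : Fin n) (x : Vec p) :
    gradient (GTSAGA.localF (f i)) x = mean fun j => gradient (f i j) x :=
  (LSmooth.mean (hf.lsmooth i)).2 x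

variable [NeZero n]

theorem IsSmooth.globalF (hf : IsSmooth f L) : LSmooth (globalF f) L := by
  rw [globalF_eq]
  exact (LSmooth.mean hf.localF).1

theorem IsSmooth.gradient_globalF (hf : IsSmooth f L) (x : Vec p) :
    gradient (GTSAGA.globalF f) x = mean fun i => gradient (GTSAGA.localF (f i)) x := by
  rw [globalF_eq]
  exact (LSmooth.mean hf.localF).2 x

/-- A gradient step of length `1 / L` lowers the quadratic upper bound as far as possible, yet
cannot go below the infimum. -/
theorem IsSmooth.norm_gradient_sq_le (hf : IsSmooth f L) (x : Vec p) :
    ‖gradient (GTSAGA.globalF f) x‖ ^ 2 ≤ 2 * L * (GTSAGA.globalF f x - optVal f) := by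
  have hL := hf.L_pos
  have h1 := hf.globalF.le_quadratic x (-(1 / L) • gradient (GTSAGA.globalF f) x)
  have h2 := hf.optVal_le (x + -(1 / L) • gradient (GTSAGA.globalF f) x)
  rw [inner_smul_right, real_inner_self_eq_norm_sq, norm_smul, mul_pow, Real.norm_eq_abs,
    sq_abs] at h1
  have h3 : L / 2 * ((-(1 / L)) ^ 2 * ‖gradient (GTSAGA.globalF f) x‖ ^ 2) =
      1 / (2 * L) * ‖gradient (GTSAGA.globalF f) x‖ ^ 2 := by
    field_simp
  have h4 : -(1 / L) * ‖gradient (GTSAGA.globalF f) x‖ ^ 2 =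
      -2 * (1 / (2 * L) * ‖gradient (GTSAGA.globalF f) x‖ ^ 2) := by
    field_simp
  have h5 : 1 / (2 * L) * ‖gradient (GTSAGA.globalF f) x‖ ^ 2 ≤
      GTSAGA.globalF f x - optVal f := by linarith
  have h6 := mul_le_mul_of_nonneg_left h5 (by positivity : 0 ≤ 2 * L)
  rwa [← mul_assoc, mul_one_div_cancel (by positivity), one_mul] at h6

/-- The averaged optimality gap is controlled by the gap of the average and the consensus error. -/
theorem IsSmooth.mean_gap_le (hf : IsSmooth f L) (x : Fin n → Vec p) :
    mean (fun i => GTSAGA.globalF f (x i)) ≤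
      GTSAGA.globalF f (mean x) + L / 2 * msq (fun i => x i - mean x) := by
  have h : ∀ i, GTSAGA.globalF f (x i) ≤ GTSAGA.globalF f (mean x) +
      inner ℝ (gradient (GTSAGA.globalF f) (mean x)) (x i - mean x) +
      L / 2 * ‖x i - mean x‖ ^ 2 := by
    intro i
    have := hf.globalF.le_quadratic (mean x) (x i - mean x)
    rwa [add_sub_cancel] at this
  refine (mean_mono h).trans ?_
  rw [mean_add, mean_add, mean_const, mean_inner, mean_sub_mean, mean_mul]
  simp [msq]

end Objective

/-- Bias-variance decomposition, node by node; used to separate the centred noise from the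
deterministic part of a step. -/
theorem mean_msq_add {ι κ E : Type*} [Fintype ι] [Fintype κ] [Nonempty ι]
    [NormedAddCommGroup E] [InnerProductSpace ℝ E] (a : κ → E) (b : ι → κ → E)
    (hb : ∀ i, mean (fun t => b t i) = 0) :
    mean (fun t => msq fun i => a i + b t i) = msq a + mean fun t => msq (b t) := by
  simp only [msq]
  rw [mean_comm, mean_comm fun t i => ‖b t i‖ ^ 2, ← mean_add]
  congr 1
  ext i
  exact msq_const_add (a i) (hb i)

theorem mean_ite_eq {m : ℕ} [NeZero m] (j : Fin m) (a b : ℝ) :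
    mean (fun l : Fin m => if j = l then a else b) = 1 / (m : ℝ) * a + (1 - 1 / (m : ℝ)) * b := by
  have h : ∀ l : Fin m, (if j = l then a else b) = b + (if j = l then a - b else 0) := by
    intro l; split_ifs <;> ring
  simp only [h]
  rw [mean_add, mean_const]
  simp [mean]
  ring

/-! ### Deviations from the average -/

section Deviation

variable {n p : ℕ} {W : Matrix (Fin n) (Fin n) ℝ}

/-- The deviations of the nodes from their average. -/
def dev (u : Fin n → Vec p) : Fin n → Vec p := fun i => u i - mean u

theorem mean_dev [NeZero n] (u : Fin n → Vec p) : mean (dev u) = 0 := mean_sub_mean u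

theorem msq_dev_le [NeZero n] (u : Fin n → Vec p) : msq (dev u) ≤ msq u := msq_sub_mean_le u

theorem dev_add (u v : Fin n → Vec p) : dev (u + v) = dev u + dev v := by
  ext1 i
  have : mean (u + v) = mean u + mean v := mean_add u v
  simp only [dev, this, Pi.add_apply]
  abel

theorem dev_sub (u v : Fin n → Vec p) : dev (u - v) = dev u - dev v := by
  ext1 i
  have : mean (u - v) = mean u - mean v := mean_sub u v
  simp only [dev, this, Pi.sub_apply]
  abel

theorem dev_smul (c : ℝ) (u : Fin n → Vec p) : dev (c • u) = c • dev u := by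
  ext1 i
  have : mean (c • u) = c • mean u := mean_smul c u
  simp only [dev, this, Pi.smul_apply, smul_sub]

theorem dev_mix (hW : IsWeight W) (u : Fin n → Vec p) : dev (mix W u) = mix W (dev u) := by
  have h : dev u = u - fun _ => mean u := rfl
  rw [h, mix_sub, mix_const hW]
  ext1 i
  simp [dev, mean_mix hW]

theorem msq_dev_mix_le [NeZero n] (hW : IsWeight W) (u : Fin n → Vec p) :
    msq (dev (mix W u)) ≤ secondSV W ^ 2 * msq (dev u) := by
  rw [dev_mix hW]
  exact msq_mix_le hW _ (mean_dev u)

theorem msq_mix_sub_self_le [NeZero n] (hW : IsWeight W) (u : Fin n → Vec p) :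
    msq (mix W u - u) ≤ 4 * msq (dev u) := by
  have h : mix W u - u = fun i => mix W (dev u) i - dev u i := by
    rw [← dev_mix hW]
    ext1 i
    simp [dev, mean_mix hW]
  have h1 := msq_sub_le (mix W (dev u)) (dev u)
  have h2 := msq_mix_le hW _ (mean_dev u)
  have h3 := secondSV_nonneg W
  have h4 := hW.secondSV_lt_one
  have h5 := msq_nonneg (dev u)
  rw [h]
  have h6 : secondSV W ^ 2 * msq (dev u) ≤ 1 * msq (dev u) :=
    mul_le_mul_of_nonneg_right (pow_le_one₀ h3 h4.le) h5
  linarith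

end Deviation

/-! ### One iteration from a fixed state -/

section Step

variable {n m p : ℕ} (f : Fin n → Fin m → Vec p → ℝ) (W : Matrix (Fin n) (Fin n) ℝ) (α : ℝ)

/-- The local gradients at the local points. -/
def localGrad (x : Fin n → Vec p) : Fin n → Vec p := fun i => gradient (localF (f i)) (x i)

/-- The sampling noise of the gradient estimator of node `i` for the sampled index `j`. -/
def noise (S : NetState n m p) (i : Fin n) (j : Fin m) : Vec p :=
  sagaEstimator (f i) (S.x i) (S.z i) j - localGrad f S.x i

/-- The noise of all the nodes for the sampled indices `t`. -/
def noiseVec (S : NetState n m p) (t : Fin n → Fin m) : Fin n → Vec p := fun i => noise f S i (t i)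

/-- The conditional expectation of the next tracker before mixing. -/
def track (S : NetState n m p) : Fin n → Vec p := S.y + localGrad f S.x - S.g

/-- The average optimality gap at the averaged point. -/
def gapErr (S : NetState n m p) : ℝ := globalF f (mean S.x) - optVal f

/-- The consensus error of the points. -/
def consErr (S : NetState n m p) : ℝ := msq (dev S.x)

/-- The mean square distance of the table points to the averaged point. -/
def tableErr (S : NetState n m p) : ℝ := mean fun i => mean fun j => ‖mean S.x - S.z i j‖ ^ 2

/-- The consensus error of the expected trackers. -/
def trackErr (S : NetState n m p) : ℝ := msq (dev (track f S))

/-- The variance of the gradient estimators, averaged over the nodes. -/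
def noiseVar (S : NetState n m p) : ℝ := mean fun i => msq (noise f S i)

/-- The expectation of `h` after one iteration from the state `S`. -/
def stepMean (h : NetState n m p → ℝ) (S : NetState n m p) : ℝ :=
  mean fun t => mean fun r => h (netStep f W α t r S)

/-- The trackers and the estimators have the same average. -/
def Tracking (S : NetState n m p) : Prop := mean S.y = mean S.g

variable {f W α}

section Formulas

variable (t r : Fin n → Fin m) (S : NetState n m p)

theorem netStep_g : (netStep f W α t r S).g = localGrad f S.x + noiseVec f S t := by
  ext1 i
  simp [netStep, noiseVec, noise]

theorem netStep_y : (netStep f W α t r S).y = mix W (track f S + noiseVec f S t) := by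
  ext1 i
  simp only [netStep, mix, track, noiseVec, noise, Pi.add_apply, Pi.sub_apply]
  refine Finset.sum_congr rfl fun l _ => ?_
  congr 1
  abel

theorem netStep_x :
    (netStep f W α t r S).x = mix W (S.x - α • mix W (track f S + noiseVec f S t)) := by
  rw [← netStep_y (W := W) (α := α) t r S]
  rfl

/-- The new noise enters the tracker mixed and leaves unmixed with the stored estimator, so only its
mixing residual remains, which is centred. -/
theorem track_netStep :
    track f (netStep f W α t r S) = mix W (track f S) +
      (mix W (noiseVec f S t) - noiseVec f S t) +
      (localGrad f (netStep f W α t r S).x - localGrad f S.x) := by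
  rw [track, netStep_y, netStep_g, mix_add]
  abel

theorem Tracking.netStep (hW : IsWeight W) {S : NetState n m p} (hS : Tracking S) :
    Tracking (netStep f W α t r S) := by
  have h : mean (track f S) = mean (localGrad f S.x) := by
    have h1 : mean (track f S) = mean S.y + mean (localGrad f S.x) - mean S.g := by
      rw [← mean_add, ← mean_sub]; rfl
    rw [h1, hS]
    abel
  have h2 : mean (track f S + noiseVec f S t) = mean (track f S) + mean (noiseVec f S t) :=
    mean_add _ _
  have h3 : mean (localGrad f S.x + noiseVec f S t) =
    mean (localGrad f S.x) + mean (noiseVec f S t) := mean_add _ _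
  rw [Tracking, netStep_y, netStep_g, mean_mix hW, h2, h3, h]

variable {S} in
theorem mean_track (hS : Tracking S) : mean (track f S) = mean (localGrad f S.x) := by
  have h1 : mean (track f S) = mean S.y + mean (localGrad f S.x) - mean S.g := by
    rw [← mean_add, ← mean_sub]; rfl
  rw [h1, hS]
  abel

/-- Column sums equal to one make mixing invisible to averages, and the tracking invariant puts the
mean local gradient in place of the tracker. -/
theorem mean_netStep_x (hW : IsWeight W) (hS : Tracking S) :
    mean (netStep f W α t r S).x =
      (mean S.x - α • mean (localGrad f S.x)) + -α • mean (noiseVec f S t) := by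
  have h1 : mean (S.x - α • mix W (track f S + noiseVec f S t)) =
      mean S.x - α • mean (mix W (track f S + noiseVec f S t)) := by
    rw [← mean_smul, ← mean_sub]; rfl
  have h2 : mean (track f S + noiseVec f S t) = mean (track f S) + mean (noiseVec f S t) :=
    mean_add _ _
  rw [netStep_x, mean_mix hW, h1, mean_mix hW, h2, mean_track hS, smul_add, neg_smul]
  abel

end Formulas

/-! ### Mean and variance of the estimator noise -/

section Noise

variable [NeZero m] {L : ℝ}

/-- Writing the noise as a family minus its average shows that it is centred and that its variance
is at most the second moment of the family. -/
theorem noise_eq (hf : IsSmooth f L) (S : NetState n m p) (i : Fin n) (j : Fin m) :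
    noise f S i j = (gradient (f i j) (S.x i) - gradient (f i j) (S.z i j)) -
      mean fun j => gradient (f i j) (S.x i) - gradient (f i j) (S.z i j) := by
  rw [mean_sub, noise, localGrad, hf.gradient_localF, sagaEstimator]
  simp only [mean, Fintype.card_fin, one_div]
  abel

theorem mean_noise (hf : IsSmooth f L) (S : NetState n m p) (i : Fin n) :
    mean (noise f S i) = 0 := by
  have h : noise f S i = fun j => _ := funext fun j => noise_eq hf S i j
  rw [h, mean_sub_mean]

theorem mean_noiseVec (hf : IsSmooth f L) (S : NetState n m p) (i : Fin n) :
    mean (fun t => noiseVec f S t i) = 0 := by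
  simp only [noiseVec]
  rw [mean_pi_apply (noise f S i) i, mean_noise hf]

theorem mean_msq_noiseVec (S : NetState n m p) :
    mean (fun t => msq (noiseVec f S t)) = noiseVar f S := by
  simp only [msq, noiseVec, noiseVar]
  rw [mean_comm]
  congr 1
  ext i
  exact mean_pi_apply (fun j => ‖noise f S i j‖ ^ 2) i

theorem mean_mean_noiseVec (hf : IsSmooth f L) (S : NetState n m p) :
    mean (fun t => mean (noiseVec f S t)) = 0 := by
  rw [mean_comm]
  simp only [mean_noiseVec hf]
  simp [mean]

theorem msq_mean_noiseVec (hf : IsSmooth f L) (S : NetState n m p) :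
    msq (fun t => mean (noiseVec f S t)) = noiseVar f S / n := by
  have h : ∀ t, ‖mean (noiseVec f S t)‖ ^ 2 = (n : ℝ)⁻¹ ^ 2 * ‖∑ i, noise f S i (t i)‖ ^ 2 := by
    intro t
    simp [mean, norm_smul, mul_pow, noiseVec]
  simp only [msq, h]
  rw [mean_mul, mean_norm_sum_sq _ (mean_noise hf S), noiseVar, mean]
  simp only [Fintype.card_fin, smul_eq_mul]
  ring

theorem noiseVar_nonneg (S : NetState n m p) : 0 ≤ noiseVar f S :=
  mean_nonneg fun _ => msq_nonneg _

/-- The variance is at most the mean square change of component gradients between `x i` and `z i j`;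
that distance is split through the average point. -/
theorem noiseVar_le (hf : IsSmooth f L) (S : NetState n m p) :
    noiseVar f S ≤ 2 * L ^ 2 * (consErr S + tableErr S) := by
  have hL := hf.L_pos
  have h : ∀ i, msq (noise f S i) ≤
      2 * L ^ 2 * (‖dev S.x i‖ ^ 2 + mean fun j => ‖mean S.x - S.z i j‖ ^ 2) := by
    intro i
    have h1 : noise f S i = fun j => _ := funext fun j => noise_eq hf S i j
    rw [h1]
    refine (msq_sub_mean_le _).trans ?_
    have h2 : ∀ j, ‖gradient (f i j) (S.x i) - gradient (f i j) (S.z i j)‖ ^ 2 ≤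
        2 * L ^ 2 * (‖dev S.x i‖ ^ 2 + ‖mean S.x - S.z i j‖ ^ 2) := by
      intro j
      have h3 : ‖gradient (f i j) (S.x i) - gradient (f i j) (S.z i j)‖ ^ 2 ≤
          (L * ‖S.x i - S.z i j‖) ^ 2 := by
        gcongr
        exact hf.lipschitz_gradient i j _ _
      have h4 := norm_add_sq_le_young (dev S.x i) (mean S.x - S.z i j) one_pos
      rw [dev, sub_add_sub_cancel] at h4
      norm_num at h4
      rw [mul_pow] at h3
      have := mul_le_mul_of_nonneg_left h4 (sq_nonneg L)
      simp only [dev]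
      linarith
    refine (mean_mono h2).trans ?_
    rw [mean_mul, mean_add, mean_const]
  refine (mean_mono h).trans ?_
  rw [mean_mul, mean_add]
  rfl

end Noise

/-! ### Expected one-step recursions of the errors -/

section Bounds

variable [NeZero n] [NeZero m] {L μ : ℝ}

theorem mean_norm_mean_netStep_x_sub (hf : IsSmooth f L) (hW : IsWeight W) {S : NetState n m p}
    (hS : Tracking S) (r : Fin n → Fin m) (w : Vec p) :
    mean (fun t => ‖mean (netStep f W α t r S).x - w‖ ^ 2) =
      ‖mean S.x - w - α • mean (localGrad f S.x)‖ ^ 2 + α ^ 2 * (noiseVar f S / n) := by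
  have h1 : ∀ t, mean (netStep f W α t r S).x - w =
      (mean S.x - w - α • mean (localGrad f S.x)) + -α • mean (noiseVec f S t) := by
    intro t
    rw [mean_netStep_x t r S hW hS]
    abel
  simp only [h1]
  have h2 := msq_const_add (mean S.x - w - α • mean (localGrad f S.x))
    (u := fun t => -α • mean (noiseVec f S t)) (by
      rw [mean_smul, mean_mean_noiseVec hf, smul_zero])
  rw [msq, msq_smul, msq_mean_noiseVec hf, neg_sq] at h2
  exact h2

theorem stepMean_move (hf : IsSmooth f L) (hW : IsWeight W) {S : NetState n m p}
    (hS : Tracking S) :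
    stepMean f W α (fun S' => ‖mean S'.x - mean S.x‖ ^ 2) S =
      α ^ 2 * (‖mean (localGrad f S.x)‖ ^ 2 + noiseVar f S / n) := by
  rw [stepMean, mean_comm]
  simp only [mean_norm_mean_netStep_x_sub hf hW hS, mean_const]
  rw [sub_self, zero_sub, norm_neg, norm_smul, mul_pow, Real.norm_eq_abs, sq_abs]
  ring

theorem norm_gradient_sub_mean_localGrad_sq_le (hf : IsSmooth f L) (x : Fin n → Vec p) :
    ‖gradient (globalF f) (mean x) - mean (localGrad f x)‖ ^ 2 ≤ L ^ 2 * msq (dev x) := by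
  rw [hf.gradient_globalF, ← mean_sub]
  refine (norm_mean_sq_le _).trans ?_
  rw [msq, msq, ← mean_mul]
  refine mean_mono fun i => ?_
  rw [← mul_pow, norm_sub_rev]
  gcongr
  exact (hf.localF i).lipschitz_gradient _ _

/-- Descent lemma at the average point. The inner product of `G` and `H` is expanded by
polarization: half of `‖G‖ ^ 2` feeds the PL inequality, half of `‖H‖ ^ 2` is kept to absorb later
terms, and `‖G - H‖` is a consensus error. -/
theorem stepMean_gapErr_le (hf : IsSmooth f L) (hPL : IsPL f μ) (hW : IsWeight W) (hα : 0 < α)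
    {S : NetState n m p} (hS : Tracking S) :
    stepMean f W α (gapErr f) S ≤ (1 - μ * α) * gapErr f S -
      α / 2 * (1 - α * L) * ‖mean (localGrad f S.x)‖ ^ 2 + α * L ^ 2 / 2 * consErr S +
      α ^ 2 * L / (2 * n) * noiseVar f S := by
  set G := gradient (globalF f) (mean S.x) with hG
  set H := mean (localGrad f S.x) with hH
  have hpt : ∀ t r, gapErr f (netStep f W α t r S) ≤ gapErr f S +
      (-α * inner ℝ G H + -α * inner ℝ G (mean (noiseVec f S t))) +
      L / 2 * ‖mean (netStep f W α t r S).x - mean S.x‖ ^ 2 := by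
    intro t r
    have h := hf.globalF.le_quadratic (mean S.x) (mean (netStep f W α t r S).x - mean S.x)
    rw [add_sub_cancel] at h
    have h2 : inner ℝ G (mean (netStep f W α t r S).x - mean S.x) =
        -α * inner ℝ G H + -α * inner ℝ G (mean (noiseVec f S t)) := by
      rw [mean_netStep_x t r S hW hS, ← hH, ← inner_smul_right, ← inner_smul_right,
        ← inner_add_right, neg_smul, neg_smul]
      congr 1
      abel
    rw [← hG, h2] at h
    simp only [gapErr]
    linarith
  have h1 : stepMean f W α (gapErr f) S ≤ gapErr f S + -α * inner ℝ G H +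
      L / 2 * (α ^ 2 * (‖H‖ ^ 2 + noiseVar f S / n)) := by
    rw [← stepMean_move hf hW hS]
    refine (mean_mono fun t => mean_mono fun r => hpt t r).trans (le_of_eq ?_)
    simp only [stepMean, mean_add, mean_const, mean_mul, mean_inner, mean_mean_noiseVec hf,
      inner_zero_right, mul_zero, add_zero]
  have h2 := norm_gradient_sub_mean_localGrad_sq_le hf S.x
  rw [← hG, ← hH, norm_sub_sq_real] at h2
  have h3 := hPL.ineq (mean S.x)
  rw [← hG] at h3
  have h4 : L / 2 * (α ^ 2 * (‖H‖ ^ 2 + noiseVar f S / n)) =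
      α ^ 2 * L / 2 * ‖H‖ ^ 2 + α ^ 2 * L / (2 * n) * noiseVar f S := by
    field_simp
  have h5 := mul_le_mul_of_nonneg_left h2 (half_pos hα).le
  have h6 := mul_le_mul_of_nonneg_left h3 (half_pos hα).le
  simp only [gapErr, consErr] at *
  nlinarith

/-- A table point is refreshed with probability `1 / m` and then costs a consensus error; otherwise
Young's inequality with parameter `1 / (2 * m)` spends half of the contraction on the motion of the
average. -/
theorem stepMean_tableErr_le (hf : IsSmooth f L) (hW : IsWeight W)
    {S : NetState n m p} (hS : Tracking S) :
    stepMean f W α tableErr S ≤ (1 - 1 / (2 * m)) * tableErr S + 1 / m * consErr S +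
      2 * m * α ^ 2 * ‖mean (localGrad f S.x)‖ ^ 2 + α ^ 2 / n * noiseVar f S := by
  set H := mean (localGrad f S.x) with hH
  have hm : (1 : ℝ) ≤ m := by exact_mod_cast NeZero.one_le
  have hn : (0 : ℝ) < n := by exact_mod_cast NeZero.pos n
  set V := α ^ 2 * (noiseVar f S / n) with hV
  have h1 : stepMean f W α tableErr S = mean fun i => mean fun j =>
      1 / (m : ℝ) * (‖mean S.x - S.x i - α • H‖ ^ 2 + V) +
        (1 - 1 / (m : ℝ)) * (‖mean S.x - S.z i j - α • H‖ ^ 2 + V) := by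
    -- The new average point does not depend on the refresh indices `r`, so an arbitrary choice,
    -- zero, is inserted for them.
    have hr : ∀ t, (mean fun r => tableErr (netStep f W α t r S)) =
        mean fun i => mean fun j =>
          1 / (m : ℝ) * ‖mean (netStep f W α t (fun _ => 0) S).x - S.x i‖ ^ 2 +
          (1 - 1 / (m : ℝ)) * ‖mean (netStep f W α t (fun _ => 0) S).x - S.z i j‖ ^ 2 := by
      intro t
      simp only [tableErr]
      rw [mean_comm]
      congr 1; ext i
      rw [mean_comm]
      congr 1; ext j
      have h : ∀ r : Fin n → Fin m,
          ‖mean (netStep f W α t r S).x - (netStep f W α t r S).z i j‖ ^ 2 =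
          if j = r i then ‖mean (netStep f W α t (fun _ => 0) S).x - S.x i‖ ^ 2
          else ‖mean (netStep f W α t (fun _ => 0) S).x - S.z i j‖ ^ 2 := by
        intro r
        simp only [netStep]
        split_ifs <;> rfl
      simp only [h]
      rw [mean_pi_apply (fun l => if j = l then
        ‖mean (netStep f W α t (fun _ => 0) S).x - S.x i‖ ^ 2
        else ‖mean (netStep f W α t (fun _ => 0) S).x - S.z i j‖ ^ 2) i, mean_ite_eq]
    simp only [stepMean, hr]
    rw [mean_comm]
    congr 1; ext i
    rw [mean_comm]
    congr 1; ext j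
    rw [mean_add, mean_mul, mean_mul, mean_norm_mean_netStep_x_sub hf hW hS,
      mean_norm_mean_netStep_x_sub hf hW hS]
  -- The cross terms cancel over the nodes because the deviations have zero average.
  have h2 : (mean fun i => ‖mean S.x - S.x i - α • H‖ ^ 2) = α ^ 2 * ‖H‖ ^ 2 + consErr S := by
    have h := msq_const_add (α • H) (mean_dev S.x)
    rw [norm_smul, mul_pow, Real.norm_eq_abs, sq_abs] at h
    rw [consErr, ← h, msq]
    congr 1; ext i
    rw [← norm_neg]
    congr 2
    simp only [dev]
    abel
  have h3 : ∀ i j, ‖mean S.x - S.z i j - α • H‖ ^ 2 ≤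
      (1 + 1 / (2 * m)) * ‖mean S.x - S.z i j‖ ^ 2 + (1 + 2 * m) * (α ^ 2 * ‖H‖ ^ 2) := by
    intro i j
    have h := norm_add_sq_le_young (mean S.x - S.z i j) (-(α • H))
      (by positivity : (0 : ℝ) < 1 / (2 * m))
    rw [← sub_eq_add_neg, norm_neg, norm_smul, mul_pow, Real.norm_eq_abs, sq_abs,
      one_div_one_div] at h
    exact h
  have hq : 0 ≤ 1 - 1 / (m : ℝ) := by
    rw [sub_nonneg, div_le_one (by linarith)]; exact hm
  have h4 : stepMean f W α tableErr S ≤ 1 / (m : ℝ) * (α ^ 2 * ‖H‖ ^ 2 + consErr S + V) +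
      (1 - 1 / (m : ℝ)) * ((1 + 1 / (2 * m)) * tableErr S +
        (1 + 2 * m) * (α ^ 2 * ‖H‖ ^ 2) + V) := by
    rw [h1, ← h2]
    refine (mean_mono fun i => mean_mono fun j => add_le_add_right
      (mul_le_mul_of_nonneg_left (add_le_add_left (h3 i j) V) hq) _).trans (le_of_eq ?_)
    simp only [mean_add, mean_mul, mean_const, tableErr]
  have hT : 0 ≤ tableErr S := mean_nonneg fun i => mean_nonneg fun j => sq_nonneg _
  have hH0 : 0 ≤ α ^ 2 * ‖H‖ ^ 2 := by positivity
  have hinv : 0 < 1 / (m : ℝ) := by positivity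
  have hmi : (m : ℝ) * (1 / m) = 1 := mul_one_div_cancel (by positivity)
  have e1 : 1 / (2 * (m : ℝ)) = 1 / 2 * (1 / m) := by field_simp
  have e2 : α ^ 2 / n * noiseVar f S = V := by rw [hV]; ring
  rw [e2]
  rw [e1] at h4 ⊢
  have e3 : (1 - 1 / (m : ℝ)) * ((1 + 2 * m) * (α ^ 2 * ‖H‖ ^ 2)) =
      (2 * m - 1 - 1 / m) * (α ^ 2 * ‖H‖ ^ 2) := by linear_combination -2 * α ^ 2 * ‖H‖ ^ 2 * hmi
  nlinarith [mul_nonneg (mul_self_nonneg (1 / (m : ℝ))) hT]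

theorem mean_dev_noiseVec (hf : IsSmooth f L) (S : NetState n m p) (i : Fin n) :
    mean (fun t => dev (noiseVec f S t) i) = 0 := by
  simp only [dev]
  rw [mean_sub, mean_noiseVec hf, mean_mean_noiseVec hf, sub_zero]

theorem mean_mix_apply {ι : Type*} [Fintype ι] (b : ι → Fin n → Vec p) (i : Fin n) :
    mean (fun t => mix W (b t) i) = mix W (fun l => mean fun t => b t l) i := by
  simp only [mix]
  rw [mean_sum]
  simp only [mean_smul]

theorem mean_mix_dev_noiseVec (hf : IsSmooth f L) (S : NetState n m p) (i : Fin n) :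
    mean (fun t => mix W (dev (noiseVec f S t)) i) = 0 := by
  rw [mean_mix_apply]
  simp [mean_dev_noiseVec hf, mix]

theorem mean_mix_mix_dev_noiseVec (hf : IsSmooth f L) (S : NetState n m p) (i : Fin n) :
    mean (fun t => mix W (mix W (dev (noiseVec f S t))) i) = 0 := by
  rw [mean_mix_apply]
  simp only [mean_mix_dev_noiseVec hf]
  simp [mix]

theorem dev_netStep_x (hW : IsWeight W) (t r : Fin n → Fin m) (S : NetState n m p) :
    dev (netStep f W α t r S).x = mix W (dev S.x - α • mix W (dev (track f S))) +
      -α • mix W (mix W (dev (noiseVec f S t))) := by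
  rw [netStep_x, dev_mix hW, dev_sub, dev_smul, dev_mix hW, dev_add, mix_add, smul_add,
    ← sub_sub, mix_sub, mix_smul α (mix W (dev (noiseVec f S t))), neg_smul, sub_eq_add_neg]

theorem msq_mix_mix_dev_le (hW : IsWeight W) (u : Fin n → Vec p) :
    msq (mix W (mix W (dev u))) ≤ secondSV W ^ 4 * msq (dev u) := by
  have h1 := msq_mix_le hW (dev u) (mean_dev u)
  have h2 := msq_mix_le hW (mix W (dev u)) (by rw [mean_mix hW, mean_dev])
  have h3 := mul_le_mul_of_nonneg_left h1 (sq_nonneg (secondSV W))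
  calc _ ≤ _ := h2
    _ ≤ _ := h3
    _ = _ := by ring

theorem mean_msq_mix_mix_noise_le (hW : IsWeight W) (S : NetState n m p) :
    mean (fun t => msq (-α • mix W (mix W (dev (noiseVec f S t))))) ≤
      α ^ 2 * secondSV W ^ 4 * noiseVar f S := by
  rw [← mean_msq_noiseVec, ← mean_mul]
  refine mean_mono fun t => ?_
  have h1 := msq_mix_mix_dev_le hW (noiseVec f S t)
  have h2 := msq_dev_le (noiseVec f S t)
  have h3 : msq (-α • mix W (mix W (dev (noiseVec f S t)))) =
      (-α) ^ 2 * msq (mix W (mix W (dev (noiseVec f S t)))) := msq_smul _ _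
  rw [h3, neg_sq, mul_assoc]
  have h4 : 0 ≤ secondSV W ^ 4 := by positivity
  gcongr
  exact h1.trans (by gcongr)

/-- The tracker is mixed once to form `y` and again with `x`, whence the fourth power. Young's
inequality with parameter `(1 - lam ^ 2) / 2` trades the contraction factor `lam ^ 2` for `(1 + lam
^ 2) / 2`. -/
theorem stepMean_consErr_le (hf : IsSmooth f L) (hW : IsWeight W) (S : NetState n m p) :
    stepMean f W α consErr S ≤ (1 + secondSV W ^ 2) / 2 * consErr S +
      3 * α ^ 2 * secondSV W ^ 4 / (1 - secondSV W ^ 2) * trackErr f S +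
      α ^ 2 * secondSV W ^ 4 * noiseVar f S := by
  have h0 := secondSV_nonneg W
  have h1 := hW.secondSV_lt_one
  have hd : 0 < 1 - secondSV W ^ 2 := by nlinarith
  have hx : 0 ≤ consErr S := msq_nonneg _
  have hq : 0 ≤ trackErr f S := msq_nonneg _
  set lam := secondSV W with hlam
  set a := dev S.x - α • mix W (dev (track f S)) with ha
  have e : stepMean f W α consErr S = msq (mix W a) +
      mean (fun t => msq (-α • mix W (mix W (dev (noiseVec f S t))))) := by
    simp only [stepMean, consErr, dev_netStep_x hW, mean_const]
    refine mean_msq_add _ _ fun i => ?_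
    have := mean_smul (-α) fun t => mix W (mix W (dev (noiseVec f S t))) i
    rw [mean_mix_mix_dev_noiseVec hf, smul_zero] at this
    exact this
  rw [e]
  refine add_le_add ?_ (mean_msq_mix_mix_noise_le hW S)
  have ha0 : mean a = 0 := by
    have : mean a = mean (dev S.x) - α • mean (mix W (dev (track f S))) := by
      rw [← mean_smul, ← mean_sub]; rfl
    rw [this, mean_mix hW, mean_dev, mean_dev, smul_zero, sub_zero]
  refine (msq_mix_le hW a ha0).trans ?_
  have h2 := msq_add_le_young (dev S.x) (fun i => -α • mix W (dev (track f S)) i) (half_pos hd)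
  have h3 : (fun i => dev S.x i + -α • mix W (dev (track f S)) i) = a := by
    ext1 i
    simp [ha, sub_eq_add_neg]
  rw [h3, msq_smul, neg_sq] at h2
  have h4 := msq_mix_le hW _ (mean_dev (track f S))
  have h5 : 1 + 1 / ((1 - lam ^ 2) / 2) ≤ 3 / (1 - lam ^ 2) := by
    rw [one_div_div, ← sub_nonneg]
    have : 3 / (1 - lam ^ 2) - (1 + 2 / (1 - lam ^ 2)) = lam ^ 2 / (1 - lam ^ 2) := by
      field_simp
      ring
    rw [this]
    positivity
  have h6 : lam ^ 2 * (1 + (1 - lam ^ 2) / 2) ≤ (1 + lam ^ 2) / 2 := by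
    nlinarith [sq_nonneg (1 - lam ^ 2)]
  calc lam ^ 2 * msq a ≤ lam ^ 2 * ((1 + (1 - lam ^ 2) / 2) * consErr S +
        3 / (1 - lam ^ 2) * (α ^ 2 * (lam ^ 2 * trackErr f S))) := by
        refine mul_le_mul_of_nonneg_left (h2.trans ?_) (sq_nonneg _)
        refine add_le_add le_rfl (mul_le_mul h5 ?_ ?_ (by positivity))
        · exact mul_le_mul_of_nonneg_left h4 (sq_nonneg _)
        · exact mul_nonneg (sq_nonneg _) (msq_nonneg _)
    _ = lam ^ 2 * (1 + (1 - lam ^ 2) / 2) * consErr S +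
        3 * α ^ 2 * lam ^ 4 / (1 - lam ^ 2) * trackErr f S := by ring
    _ ≤ _ := by gcongr

/-- The motion splits orthogonally into that of the average and that of the deviations; in each part
the noise contributes only its variance. -/
theorem stepMean_msq_move_le (hf : IsSmooth f L) (hW : IsWeight W) {S : NetState n m p}
    (hS : Tracking S) :
    stepMean f W α (fun S' => msq (S'.x - S.x)) S ≤
      α ^ 2 * (‖mean (localGrad f S.x)‖ ^ 2 + noiseVar f S / n) + 8 * consErr S +
      2 * α ^ 2 * secondSV W ^ 4 * trackErr f S + α ^ 2 * secondSV W ^ 4 * noiseVar f S := by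
  have e : ∀ S' : NetState n m p, msq (S'.x - S.x) =
      ‖mean S'.x - mean S.x‖ ^ 2 + msq (dev S'.x - dev S.x) := by
    intro S'
    have h : mean (S'.x - S.x) = mean S'.x - mean S.x := mean_sub _ _
    rw [msq_eq_add_msq_sub_mean, ← dev_sub, ← h]
    rfl
  simp only [e]
  have h1 : stepMean f W α (fun S' => ‖mean S'.x - mean S.x‖ ^ 2 + msq (dev S'.x - dev S.x)) S =
      stepMean f W α (fun S' => ‖mean S'.x - mean S.x‖ ^ 2) S +
      stepMean f W α (fun S' => msq (dev S'.x - dev S.x)) S := by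
    simp only [stepMean, mean_add]
  rw [h1, stepMean_move hf hW hS]
  set a := (mix W (dev S.x) - dev S.x) - α • mix W (mix W (dev (track f S))) with ha
  have h2 : stepMean f W α (fun S' => msq (dev S'.x - dev S.x)) S = msq a +
      mean (fun t => msq (-α • mix W (mix W (dev (noiseVec f S t))))) := by
    have h3 : ∀ t r, dev (netStep f W α t r S).x - dev S.x =
        a + -α • mix W (mix W (dev (noiseVec f S t))) := by
      intro t r
      rw [dev_netStep_x hW, mix_sub, mix_smul, ha]
      abel
    simp only [stepMean, h3, mean_const]
    refine mean_msq_add _ _ fun i => ?_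
    have := mean_smul (-α) fun t => mix W (mix W (dev (noiseVec f S t))) i
    rw [mean_mix_mix_dev_noiseVec hf, smul_zero] at this
    exact this
  rw [h2]
  have h3 : msq a ≤ 2 * msq (mix W (dev S.x) - dev S.x) +
      2 * (α ^ 2 * msq (mix W (mix W (dev (track f S))))) := by
    rw [← msq_smul]
    exact msq_sub_le _ _
  have h4 : msq (mix W (dev S.x) - dev S.x) ≤ 4 * consErr S := by
    have := msq_mix_sub_self_le hW (dev S.x)
    have h : dev (dev S.x) = dev S.x := by
      ext1 i
      rw [dev, mean_dev, sub_zero]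
    rwa [h] at this
  have h5 := mul_le_mul_of_nonneg_left (msq_mix_mix_dev_le hW (track f S)) (sq_nonneg α)
  have h6 := mean_msq_mix_mix_noise_le (f := f) (α := α) hW S
  have h7 : msq (dev (track f S)) = trackErr f S := rfl
  rw [h7] at h5
  linarith

theorem msq_localGrad_sub_le (hf : IsSmooth f L) (x x' : Fin n → Vec p) :
    msq (localGrad f x' - localGrad f x) ≤ L ^ 2 * msq (x' - x) := by
  rw [msq, msq, ← mean_mul]
  refine mean_mono fun i => ?_
  rw [← mul_pow]
  gcongr
  exact (hf.localF i).lipschitz_gradient _ _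

theorem stepMean_trackErr_le (hf : IsSmooth f L) (hW : IsWeight W) (S : NetState n m p) :
    stepMean f W α (trackErr f) S ≤ (1 + secondSV W ^ 2) / 2 * trackErr f S +
      6 * noiseVar f S + 3 * L ^ 2 / (1 - secondSV W ^ 2) *
        stepMean f W α (fun S' => msq (S'.x - S.x)) S := by
  have h0 := secondSV_nonneg W
  have h1 := hW.secondSV_lt_one
  have hd : 0 < 1 - secondSV W ^ 2 := by nlinarith
  have hq : 0 ≤ trackErr f S := msq_nonneg _
  have hN := noiseVar_nonneg (f := f) S
  set lam := secondSV W with hlam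
  set a := dev (mix W (track f S)) with ha
  set b : (Fin n → Fin m) → Fin n → Vec p :=
    fun t => mix W (dev (noiseVec f S t)) - dev (noiseVec f S t) with hb
  have h5 : 1 + 1 / ((1 - lam ^ 2) / 2) ≤ 3 / (1 - lam ^ 2) := by
    rw [one_div_div, ← sub_nonneg]
    have : 3 / (1 - lam ^ 2) - (1 + 2 / (1 - lam ^ 2)) = lam ^ 2 / (1 - lam ^ 2) := by
      field_simp
      ring
    rw [this]
    positivity
  have h6 : lam ^ 2 * (1 + (1 - lam ^ 2) / 2) ≤ (1 + lam ^ 2) / 2 := by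
    nlinarith [sq_nonneg (1 - lam ^ 2)]
  -- The gradient change at the new points is correlated with the noise, so Young's inequality
  -- separates it before averaging; centredness is used only on the rest.
  have hpt : ∀ t r, trackErr f (netStep f W α t r S) ≤
      (1 + (1 - lam ^ 2) / 2) * msq (fun i => a i + b t i) +
      3 * L ^ 2 / (1 - lam ^ 2) * msq ((netStep f W α t r S).x - S.x) := by
    intro t r
    have e : dev (track f (netStep f W α t r S)) = fun i => (a i + b t i) +
        dev (localGrad f (netStep f W α t r S).x - localGrad f S.x) i := by
      rw [track_netStep, dev_add, dev_add, dev_sub (mix W _), dev_mix hW (noiseVec f S t)]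
      rfl
    rw [trackErr, e]
    refine (msq_add_le_young _ _ (half_pos hd)).trans (add_le_add le_rfl ?_)
    have h := (msq_dev_le _).trans (msq_localGrad_sub_le hf S.x (netStep f W α t r S).x)
    calc _ ≤ 3 / (1 - lam ^ 2) * (L ^ 2 * msq ((netStep f W α t r S).x - S.x)) :=
          mul_le_mul h5 h (msq_nonneg _) (by positivity)
      _ = _ := by ring
  have h2 : mean (fun t => msq fun i => a i + b t i) = msq a + mean fun t => msq (b t) := by
    refine mean_msq_add _ _ fun i => ?_
    have := mean_sub (fun t => mix W (dev (noiseVec f S t)) i) fun t => dev (noiseVec f S t) i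
    rw [mean_mix_dev_noiseVec hf, mean_dev_noiseVec hf, sub_zero] at this
    exact this
  have h3 : msq a ≤ lam ^ 2 * trackErr f S := msq_dev_mix_le hW _
  have h4 : (mean fun t => msq (b t)) ≤ 4 * noiseVar f S := by
    rw [← mean_msq_noiseVec, ← mean_mul]
    refine mean_mono fun t => ?_
    refine (msq_mix_sub_self_le hW _).trans ?_
    have := (msq_dev_le (dev (noiseVec f S t))).trans (msq_dev_le (noiseVec f S t))
    linarith
  refine (mean_mono fun t => mean_mono fun r => hpt t r).trans ?_
  simp only [mean_add, mean_mul, mean_const, stepMean]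
  rw [h2]
  have h7 : (1 + (1 - lam ^ 2) / 2) * (msq a + mean fun t => msq (b t)) ≤
      (1 + (1 - lam ^ 2) / 2) * (lam ^ 2 * trackErr f S + 4 * noiseVar f S) := by gcongr
  have h8 := mul_le_mul_of_nonneg_right h6 hq
  have h9 : (1 + (1 - lam ^ 2) / 2) * (4 * noiseVar f S) ≤ 6 * noiseVar f S := by
    nlinarith [mul_nonneg (sq_nonneg lam) hN]
  linarith

end Bounds

end Step

/-! ### Choice of the Lyapunov weights -/

/-- The smallness of the quantities that link the errors to each other. -/
theorem step_estimates {n m lam th : ℝ} (hn : 1 ≤ n) (hm : 1 ≤ m) (h0 : 0 ≤ lam) (h1 : lam < 1)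
    (hth : 0 < th) (hth1 : th ≤ 1 / 36) (hA : 55 * lam * th ≤ (1 - lam ^ 2) ^ 2)
    (hB : 388 * lam ^ 2 * n * th ≤ (1 - lam ^ 2) ^ 3) (hC : 1157 * m ^ 2 * th ^ 3 ≤ n)
    {d E β : ℝ} (hd : d = 1 - lam ^ 2) (hd0 : 0 < d) (hd1 : d ≤ 1)
    (hE : E = th ^ 2 * lam ^ 4 / d ^ 3) (hβ : β = 6 * (th ^ 2 / n) + 5000 * (th * E)) :
    E / d ≤ 1 / 3025 ∧ E ≤ 1 / 12100 ∧ th ^ 2 / d ≤ 1 / 400 ∧ m * (th ^ 2 / n) ≤ 1 / 200 ∧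
      m ^ 2 * th * β ≤ 1 / 50 ∧ th ^ 2 / n ≤ th / 36 := by
  rw [← hd] at hA hB
  have hEle : E / d ≤ 1 / 3025 := by
    rw [div_le_iff₀ hd0, hE, div_le_iff₀ (by positivity)]
    have h2 : (55 * lam * th) ^ 2 ≤ (d ^ 2) ^ 2 := by gcongr
    have h3 : lam ^ 2 * (55 * lam * th) ^ 2 ≤ 1 * (d ^ 2) ^ 2 :=
      mul_le_mul (pow_le_one₀ h0 h1.le) h2 (by positivity) zero_le_one
    nlinarith
  -- The extra factor of four over `55 ^ 2` comes from `lam ^ 2 * (1 - lam ^ 2) ≤ 1 / 4`.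
  have hE4 : E ≤ 1 / 12100 := by
    rw [hE, div_le_iff₀ (by positivity)]
    have h2 : (55 * lam * th) ^ 2 ≤ (d ^ 2) ^ 2 := by gcongr
    have h3 := mul_le_mul_of_nonneg_left h2 (sq_nonneg lam)
    have h4 : lam ^ 2 * d ≤ 1 / 4 := by
      rw [hd]; nlinarith [sq_nonneg (1 - 2 * lam ^ 2)]
    have h5 := mul_le_mul_of_nonneg_right h4 (pow_nonneg hd0.le 3)
    nlinarith
  -- For small `lam` the bound `1 / 36` suffices since `d ≥ 3 / 4`; for large `lam` the network
  -- bound gives `27.5 * th ≤ d ^ 2`.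
  have hthd : th ≤ d ^ 2 / 20 := by
    rcases le_total lam (1 / 2) with h | h
    · have : 3 / 4 ≤ d := by rw [hd]; nlinarith
      nlinarith
    · nlinarith
  have hthdd : th ^ 2 / d ≤ 1 / 400 := by
    rw [div_le_iff₀ hd0]
    have h2 : th ^ 2 ≤ (d ^ 2 / 20) ^ 2 := by gcongr
    have h3 : d ^ 4 ≤ d := pow_le_of_le_one hd0.le hd1 (by norm_num)
    nlinarith
  have hq : m * (th ^ 2 / n) ≤ 1 / 200 := by
    have h2 : (m * (th ^ 2 / n)) ^ 2 = (m ^ 2 * th ^ 3 / n) * (th / n) := by field_simp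
    have h3 : m ^ 2 * th ^ 3 / n ≤ 1 / 1157 := by
      rw [div_le_iff₀ (by linarith)]; linarith
    have h4 : th / n ≤ 1 / 36 := (div_le_self hth.le hn).trans hth1
    have h5 : (m * (th ^ 2 / n)) ^ 2 ≤ (1 / 200) ^ 2 := by
      rw [h2]
      calc _ ≤ 1 / 1157 * (1 / 36 : ℝ) := mul_le_mul h3 h4 (by positivity) (by norm_num)
        _ ≤ _ := by norm_num
    exact le_of_sq_le_sq h5 (by norm_num)
  have hr : m ^ 2 * th ^ 3 / n ≤ 1 / 1157 := by
    rw [div_le_iff₀ (by linarith)]; linarith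
  -- This is where the network bound with constant 388 enters: it controls the part of `β` that
  -- comes from `E`.
  have hmβ : m ^ 2 * th * β ≤ 1 / 50 := by
    have h2 : m ^ 2 * th * β = 6 * (m ^ 2 * th ^ 3 / n) +
        5000 * ((m ^ 2 * th ^ 3 / n) * (n * th * lam ^ 4 / d ^ 3)) := by
      rw [hβ, hE]; field_simp
    have h3 : n * th * lam ^ 4 / d ^ 3 ≤ 1 / 388 := by
      rw [div_le_iff₀ (by positivity)]
      have h4 : lam ^ 2 * (388 * lam ^ 2 * n * th) ≤ 1 * d ^ 3 :=
        mul_le_mul (pow_le_one₀ h0 h1.le) hB (by positivity) zero_le_one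
      nlinarith
    have h5 : (m ^ 2 * th ^ 3 / n) * (n * th * lam ^ 4 / d ^ 3) ≤ 1 / 1157 * (1 / 388) :=
      mul_le_mul hr h3 (by positivity) (by norm_num)
    rw [h2]
    linarith
  refine ⟨hEle, hE4, hthdd, hq, hmβ, (div_le_self (sq_nonneg _) hn).trans ?_⟩
  nlinarith

/-- The weights of the errors in the Lyapunov function, in units of `L`, with `th = α L`. -/
theorem exists_weights {n m lam th : ℝ} (hn : 1 ≤ n) (hm : 1 ≤ m) (h0 : 0 ≤ lam) (h1 : lam < 1)
    (hth : 0 < th) (hth1 : th ≤ 1 / 36) (hA : 55 * lam * th ≤ (1 - lam ^ 2) ^ 2)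
    (hB : 388 * lam ^ 2 * n * th ≤ (1 - lam ^ 2) ^ 3) (hC : 1157 * m ^ 2 * th ^ 3 ≤ n) :
    ∃ a b c N : ℝ, 0 < a ∧ 0 < b ∧ 0 ≤ c ∧ 0 ≤ N ∧
      N = th ^ 2 / (2 * n) + a * (th ^ 2 * lam ^ 4) + b * (th ^ 2 / n) +
        c * (6 + 3 / (1 - lam ^ 2) * (th ^ 2 / n + th ^ 2 * lam ^ 4)) ∧
      2 * m * th * b + c * (3 / (1 - lam ^ 2)) * th ≤ (1 - th) / 2 ∧
      a * (3 * th ^ 2 * lam ^ 4 / (1 - lam ^ 2)) +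
        c * (3 / (1 - lam ^ 2)) * (2 * th ^ 2 * lam ^ 4) ≤ c * ((1 - lam ^ 2) / 4) ∧
      2 * N ≤ b * (3 / (8 * m)) ∧
      th / 2 + b / m + c * (3 / (1 - lam ^ 2)) * 8 + 2 * N ≤ a * ((1 - lam ^ 2) / 4) := by
  have hd0 : 0 < 1 - lam ^ 2 := by nlinarith
  have hd1 : 1 - lam ^ 2 ≤ 1 := by nlinarith
  set d := 1 - lam ^ 2 with hd
  obtain ⟨E, hE⟩ : ∃ E, E = th ^ 2 * lam ^ 4 / d ^ 3 := ⟨_, rfl⟩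
  have hE0 : 0 ≤ E := by rw [hE]; positivity
  have hEd : E * d ^ 3 = th ^ 2 * lam ^ 4 := by rw [hE]; field_simp
  -- `β` is the table weight divided by `m`. A fifth of it, `1.2 * (th ^ 2 / n) + 1000 * (th * E)`,
  -- must cover the `th ^ 2 / n` and `960 * (th * E)` in the bound on `2 * N`.
  obtain ⟨β, hβ⟩ : ∃ β, β = 6 * (th ^ 2 / n) + 5000 * (th * E) := ⟨_, rfl⟩
  have hβ0 : 0 < β := by rw [hβ]; positivity
  obtain ⟨hEle, hE4, hthdd, hq, hmβ, hn2⟩ :=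
    step_estimates hn hm h0 h1 hth hth1 hA hB hC hd hd0 hd1 hE hβ
  -- A quarter of `a * d` is `1.5 * th + 3 * β`, which has to dominate `th / 2 + β` together with
  -- the smaller tracking and noise terms.
  obtain ⟨a, ha⟩ : ∃ a, a = (6 * th + 12 * β) / d := ⟨_, rfl⟩
  have ha0 : 0 < a := by rw [ha]; positivity
  have had : a * d = 6 * th + 12 * β := by rw [ha]; field_simp
  obtain ⟨P, hP⟩ : ∃ P, P = (6 * th + 12 * β) * E := ⟨_, rfl⟩
  have hP0 : 0 ≤ P := by rw [hP]; positivity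
  have hPa : a * (d * E) = P := by rw [hP, ← had]; ring
  have hPd : P / d ≤ (6 * th + 12 * β) * (1 / 3025) := by
    rw [hP, mul_div_assoc]; gcongr
  have hP4 : P ≤ (6 * th + 12 * β) * (1 / 12100) := by rw [hP]; gcongr
  obtain ⟨N, hN⟩ : ∃ N, N = th ^ 2 / (2 * n) + a * (th ^ 2 * lam ^ 4) + m * β * (th ^ 2 / n) +
    13 * P * (6 + 3 / d * (th ^ 2 / n + th ^ 2 * lam ^ 4)) := ⟨_, rfl⟩
  have hN0 : 0 ≤ N := by rw [hN]; positivity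
  have hNle : 2 * N ≤ th ^ 2 / n + β / 100 + 160 * P := by
    have e1 : th ^ 2 / (2 * n) = th ^ 2 / n / 2 := by field_simp
    have e2 : a * (th ^ 2 * lam ^ 4) ≤ P := by
      rw [← hEd, ← hPa]
      have : d ^ 3 ≤ d := pow_le_of_le_one hd0.le hd1 (by norm_num)
      rw [mul_comm E]
      gcongr
    have e3 : m * β * (th ^ 2 / n) ≤ β / 200 := by nlinarith
    have e4 : 3 / d * (th ^ 2 / n + th ^ 2 * lam ^ 4) ≤ 6 / 400 := by
      have e5 : th ^ 2 / n ≤ th ^ 2 := div_le_self (sq_nonneg _) hn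
      have e6 : th ^ 2 * lam ^ 4 ≤ th ^ 2 :=
        mul_le_of_le_one_right (sq_nonneg _) (pow_le_one₀ h0 h1.le)
      calc _ ≤ 3 / d * (th ^ 2 + th ^ 2) := by gcongr
        _ = 6 * (th ^ 2 / d) := by ring
        _ ≤ _ := by linarith
    have e7 : 13 * P * (6 + 3 / d * (th ^ 2 / n + th ^ 2 * lam ^ 4)) ≤ 13 * P * (6 + 6 / 400) := by
      gcongr
    rw [hN, e1]
    linarith
  -- The consensus term demands `3 * P * d` from a quarter of the tracking weight times `d`; 13
  -- exceeds 12 to leave room for the tracker's effect on the motion.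
  refine ⟨a, m * β, 13 * P, N, ha0, by positivity, by positivity, hN0, hN, ?_, ?_, ?_, ?_⟩
  · have h2 : 13 * P * (3 / d) * th = 39 * (P / d) * th := by ring
    have h3 : β * th ≤ m ^ 2 * th * β := by
      have : 1 ≤ m ^ 2 := one_le_pow₀ hm
      nlinarith [mul_pos hβ0 hth]
    have h4 : P / d * th ≤ (6 * th + 12 * β) * (1 / 3025) * th := by gcongr
    have h5 : th ^ 2 ≤ (1 / 36) ^ 2 := by gcongr
    have h6 : 2 * m * th * (m * β) = 2 * (m ^ 2 * th * β) := by ring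
    have h7 : (6 * th + 12 * β) * (1 / 3025) * th = 6 / 3025 * th ^ 2 + 12 / 3025 * (β * th) := by
      ring
    rw [h7] at h4
    have h8 : 39 * (P / d) * th = 39 * (P / d * th) := by ring
    rw [h2, h6, h8]
    linarith
  · have h2 : a * (3 * th ^ 2 * lam ^ 4 / d) = 3 * P * d := by
      rw [mul_assoc 3, ← hEd, ← hPa]; field_simp
    have h3 : 13 * P * (3 / d) * (2 * th ^ 2 * lam ^ 4) = 78 * P * d * (E * d) := by
      rw [mul_assoc 2, ← hEd]; field_simp; ring
    have h4 : E * d ≤ 1 / 12100 := (mul_le_of_le_one_right hE0 hd1).trans hE4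
    have h5 : 78 * P * d * (E * d) ≤ 78 * P * d * (1 / 12100) := by gcongr
    have h6 := mul_nonneg hP0 hd0.le
    rw [h2, h3]
    linarith
  · have h2 : m * β * (3 / (8 * m)) = 3 / 8 * β := by field_simp
    have h3 : P = 6 * (th * E) + 12 * (β * E) := by rw [hP]; ring
    have h4 : β * E ≤ β * (1 / 12100) := by gcongr
    have h5 : 0 ≤ th ^ 2 / n := by positivity
    have h6 : th * E ≥ 0 := by positivity
    have h7 : β * (3 / 8 - 1 / 100 - 1920 / 12100) ≥ 1 / 5 * β := by linarith
    rw [h2]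
    linarith
  · have h2 : m * β / m = β := by field_simp
    have h3 : 13 * P * (3 / d) * 8 = 312 * (P / d) := by ring
    rw [h2, h3]
    linarith

/-- The step size bounds that the linear convergence rests on. -/
structure IsStep (n m : ℕ) (L μ lam α : ℝ) : Prop where
  pos : 0 < α
  le_inv_L : α * L ≤ 1 / 36
  network : 55 * lam * (α * L) ≤ (1 - lam ^ 2) ^ 2
  variance : 388 * lam ^ 2 * n * (α * L) ≤ (1 - lam ^ 2) ^ 3
  table : 1157 * (m : ℝ) ^ 2 * (α * L) ^ 3 ≤ n
  rate_network : μ * α / 2 ≤ (1 - lam ^ 2) / 4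
  rate_table : μ * α / 2 ≤ 1 / (8 * m)

/-! ### Contraction of the Lyapunov function -/

section Lyapunov

variable {n m p : ℕ} [NeZero n] [NeZero m] {f : Fin n → Fin m → Vec p → ℝ} {L μ α : ℝ}
  {W : Matrix (Fin n) (Fin n) ℝ}

/-- The Lyapunov function with weights `A`, `B` and `C`. -/
def lyapunov (f : Fin n → Fin m → Vec p → ℝ) (A B C : ℝ) (S : NetState n m p) : ℝ :=
  gapErr f S + A * consErr S + B * tableErr S + C * trackErr f S

theorem stepMean_lyapunov (A B C : ℝ) (S : NetState n m p) :
    stepMean f W α (lyapunov f A B C) S = stepMean f W α (gapErr f) S +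
      A * stepMean f W α consErr S + B * stepMean f W α tableErr S +
      C * stepMean f W α (trackErr f) S := by
  simp only [stepMean, lyapunov, mean_add, mean_mul]

theorem consErr_nonneg (S : NetState n m p) : 0 ≤ consErr S := msq_nonneg _

theorem trackErr_nonneg (S : NetState n m p) : 0 ≤ trackErr f S := msq_nonneg _

theorem tableErr_nonneg (S : NetState n m p) : 0 ≤ tableErr S :=
  mean_nonneg fun _ => mean_nonneg fun _ => sq_nonneg _

theorem gapErr_nonneg (hf : IsSmooth f L) (S : NetState n m p) : 0 ≤ gapErr f S :=
  sub_nonneg.2 (hf.optVal_le _)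

theorem exists_stepMean_lyapunov_le (hf : IsSmooth f L) (hPL : IsPL f μ) (hW : IsWeight W)
    (hα : IsStep n m L μ (secondSV W) α) :
    ∃ A B C : ℝ, 0 < A ∧ 0 < B ∧ 0 ≤ C ∧ ∀ S, Tracking S →
      stepMean f W α (lyapunov f A B C) S ≤ (1 - μ * α / 2) * lyapunov f A B C S := by
  have hL := hf.L_pos
  have hα0 := hα.pos
  have h0 := secondSV_nonneg W
  have h1 := hW.secondSV_lt_one
  have hd : 0 < 1 - secondSV W ^ 2 := by nlinarith
  have hm : (1 : ℝ) ≤ m := by exact_mod_cast NeZero.one_le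
  have hn : (1 : ℝ) ≤ n := by exact_mod_cast NeZero.one_le
  obtain ⟨a, b, c, N, ha, hb, hc, hN, hNeq, hH, hY, hT, hX⟩ := exists_weights hn hm h0 h1
    (mul_pos hα0 hL) hα.le_inv_L hα.network hα.variance hα.table
  -- The powers of `L` give all terms the units of the gap: squared distances are multiplied by `L`,
  -- squared gradients divided by it.
  refine ⟨L * a, L * b, c / L, by positivity, by positivity, by positivity, fun S hS => ?_⟩
  have r1 := hα.rate_network
  have r2 := hα.rate_table
  have s1 := stepMean_gapErr_le hf hPL hW hα0 hS
  have s2 := stepMean_consErr_le (α := α) hf hW S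
  have s3 := stepMean_tableErr_le (α := α) hf hW hS
  have s4 := stepMean_trackErr_le (α := α) hf hW S
  have s5 := stepMean_msq_move_le (α := α) hf hW hS
  have s6 := noiseVar_le hf S
  have p1 := gapErr_nonneg hf S
  have p2 := consErr_nonneg S
  have p3 := tableErr_nonneg S
  have p4 := trackErr_nonneg (f := f) S
  have p5 : 0 ≤ ‖mean (localGrad f S.x)‖ ^ 2 := sq_nonneg _
  rw [stepMean_lyapunov, lyapunov]
  set lam := secondSV W
  set d := 1 - lam ^ 2 with hdd
  set ρ := μ * α / 2 with hρ
  set D := gapErr f S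
  set X := consErr S
  set T := tableErr S
  set Y := trackErr f S
  set V := noiseVar f S
  set H := ‖mean (localGrad f S.x)‖ ^ 2
  set M := stepMean f W α (fun S' => msq (S'.x - S.x)) S
  have k1 : 3 * L ^ 2 / d * M ≤ 3 * L ^ 2 / d * (α ^ 2 * (H + V / n) + 8 * X +
      2 * α ^ 2 * lam ^ 4 * Y + α ^ 2 * lam ^ 4 * V) := by gcongr
  have k2 : L * a * stepMean f W α consErr S ≤ _ :=
    mul_le_mul_of_nonneg_left s2 (by positivity)
  have k3 : L * b * stepMean f W α tableErr S ≤ _ :=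
    mul_le_mul_of_nonneg_left s3 (by positivity)
  have k4 : c / L * stepMean f W α (trackErr f) S ≤ _ :=
    mul_le_mul_of_nonneg_left (s4.trans (add_le_add le_rfl k1)) (by positivity)
  -- the coefficient of each error
  have cN : N / L * V ≤ N / L * (2 * L ^ 2 * (X + T)) := by gcongr
  have cH := mul_le_mul_of_nonneg_right hH (mul_nonneg hα0.le p5)
  have cY := mul_le_mul_of_nonneg_right hY (by positivity : 0 ≤ Y / L)
  have cT := mul_le_mul_of_nonneg_right hT (mul_nonneg hL.le p3)
  have cX := mul_le_mul_of_nonneg_right hX (mul_nonneg hL.le p2)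
  have rX := mul_le_mul_of_nonneg_right r1 (by positivity : 0 ≤ L * a * X)
  have rY := mul_le_mul_of_nonneg_right r1 (by positivity : 0 ≤ c / L * Y)
  have rT := mul_le_mul_of_nonneg_right r2 (by positivity : 0 ≤ L * b * T)
  have rD : 0 ≤ ρ * D := by
    have := hPL.mu_pos
    positivity
  -- The gap contracts at twice the target rate. For the other errors `exists_weights` has already
  -- set aside the rate: `d / 2` minus `d / 4`, and `1 / (2 * m)` minus `1 / (8 * m)`.
  have e1 : (1 - μ * α) * D = D - 2 * ρ * D := by rw [hρ]; ring
  rw [e1] at s1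
  have e2 : (1 + lam ^ 2) / 2 = 1 - d / 2 := by rw [hdd]; ring
  rw [e2] at k2 k4
  -- Regroups the weighted bounds by error, with `N / L` collecting every coefficient of the noise
  -- variance.
  have total : D - 2 * ρ * D - α / 2 * (1 - α * L) * H + α * L ^ 2 / 2 * X +
        α ^ 2 * L / (2 * n) * V +
      L * a * ((1 - d / 2) * X + 3 * α ^ 2 * lam ^ 4 / d * Y + α ^ 2 * lam ^ 4 * V) +
      L * b * ((1 - 1 / (2 * m)) * T + 1 / m * X + 2 * m * α ^ 2 * H + α ^ 2 / n * V) +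
      c / L * ((1 - d / 2) * Y + 6 * V + 3 * L ^ 2 / d * (α ^ 2 * (H + V / n) + 8 * X +
        2 * α ^ 2 * lam ^ 4 * Y + α ^ 2 * lam ^ 4 * V)) =
      D - 2 * ρ * D + (N / L * V) +
      ((2 * m * (α * L) * b + c * (3 / d) * (α * L)) * (α * H) - (1 - α * L) / 2 * (α * H)) +
      ((a * (3 * (α * L) ^ 2 * lam ^ 4 / d) + c * (3 / d) * (2 * (α * L) ^ 2 * lam ^ 4)) * (Y / L) +
        c / L * Y - 2 * (c * (d / 4) * (Y / L))) +
      (L * b * T - 4 / 3 * (b * (3 / (8 * m)) * (L * T))) +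
      (L * a * X - 2 * (a * (d / 4) * (L * X)) +
        (α * L / 2 + b / m + c * (3 / d) * 8 ) * (L * X)) := by
    rw [hNeq]
    field_simp
    ring
  have e3 : N / L * (2 * L ^ 2 * (X + T)) = 2 * N * (L * X) + 2 * N * (L * T) := by
    field_simp
  have e4 : c * (d / 4) * (Y / L) = d / 4 * (c / L * Y) := by ring
  have e5 : b * (3 / (8 * m)) * (L * T) = 3 * (1 / (8 * m) * (L * b * T)) := by ring
  have e6 : a * (d / 4) * (L * X) = d / 4 * (L * a * X) := by ring
  have e7 : (α * L / 2 + b / m + c * (3 / d) * 8 + 2 * N) * (L * X) =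
      (α * L / 2 + b / m + c * (3 / d) * 8) * (L * X) + 2 * N * (L * X) := by ring
  rw [e3] at cN
  rw [e7] at cX
  linarith

end Lyapunov

/-! ### Consequences of the step-size bound -/

section StepSize

variable {n m : ℕ} {L μ lam α : ℝ}

theorem isStep_of_le_alphaBar (hn : 0 < n) (hm : 0 < m) (hL : 0 < L) (hμ : 0 < μ)
    (hκ : 1 ≤ L / μ) (h0 : 0 ≤ lam) (h1 : lam < 1) (hα : 0 < α)
    (hle : α ≤ alphaBar n m L μ lam) : IsStep n m L μ lam α := by
  have hn' : (0 : ℝ) < n := by exact_mod_cast hn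
  have hm' : (0 : ℝ) < m := by exact_mod_cast hm
  have hd : 0 < 1 - lam ^ 2 := by nlinarith
  have hb : α ≤ min (min ((n : ℝ) ^ (1 / 3 : ℝ) /
        (10.5 * (m : ℝ) ^ (2 / 3 : ℝ) * (L / μ) ^ (1 / 3 : ℝ) * L)) (1 / (36 * L)))
      (min ((1 - lam ^ 2) / (2 * μ)) (1 / (4 * m * μ))) := by
    rw [alphaBar] at hle
    split_ifs at hle with h
    · exact hle
    · exact hle.trans ((min_le_right _ _).trans (min_le_right _ _))
  simp only [le_min_iff] at hb
  obtain ⟨⟨b1, b2⟩, b3, b4⟩ := hb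
  have hnet : 55 * lam * (α * L) ≤ (1 - lam ^ 2) ^ 2 ∧
      388 * lam ^ 2 * n * (α * L) ≤ (1 - lam ^ 2) ^ 3 := by
    by_cases h : lam = 0
    · simp [h]
    · have hl : 0 < lam := lt_of_le_of_ne h0 (Ne.symm h)
      rw [alphaBar, if_neg h] at hle
      simp only [le_min_iff] at hle
      obtain ⟨⟨c1, _⟩, c2, _⟩ := hle
      rw [le_div_iff₀ (by positivity)] at c1 c2
      constructor <;> linarith
  refine ⟨hα, ?_, hnet.1, hnet.2, ?_, ?_, ?_⟩
  · rw [le_div_iff₀ (by positivity)] at b2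
    linarith
  · rw [le_div_iff₀ (by positivity)] at b1
    have hk : 1 ≤ (L / μ) ^ (1 / 3 : ℝ) := Real.one_le_rpow hκ (by norm_num)
    have b5 : α * L * (10.5 * (m : ℝ) ^ (2 / 3 : ℝ)) ≤ (n : ℝ) ^ (1 / 3 : ℝ) := by
      refine le_trans ?_ b1
      have : α * L * (10.5 * (m : ℝ) ^ (2 / 3 : ℝ)) * 1 ≤
          α * L * (10.5 * (m : ℝ) ^ (2 / 3 : ℝ)) * (L / μ) ^ (1 / 3 : ℝ) := by gcongr
      linarith
    have b6 : (α * L * (10.5 * (m : ℝ) ^ (2 / 3 : ℝ))) ^ 3 ≤ ((n : ℝ) ^ (1 / 3 : ℝ)) ^ 3 := by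
      gcongr
    have e1 : ((n : ℝ) ^ (1 / 3 : ℝ)) ^ 3 = n := by
      rw [← Real.rpow_natCast, ← Real.rpow_mul hn'.le]; norm_num
    have e2 : ((m : ℝ) ^ (2 / 3 : ℝ)) ^ 3 = (m : ℝ) ^ 2 := by
      rw [← Real.rpow_natCast, ← Real.rpow_mul hm'.le]; norm_num
    rw [e1, mul_pow (α * L), mul_pow (10.5 : ℝ), e2] at b6
    have : 0 ≤ (α * L) ^ 3 * (m : ℝ) ^ 2 := by positivity
    norm_num at b6
    linarith
  · rw [le_div_iff₀ (by positivity)] at b3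
    linarith
  · rw [le_div_iff₀ (by positivity)] at b4 ⊢
    linarith

theorem alphaBar_pos (hn : 0 < n) (hm : 0 < m) (hL : 0 < L) (hμ : 0 < μ)
    (h0 : 0 ≤ lam) (h1 : lam < 1) : 0 < alphaBar n m L μ lam := by
  have hn' : (0 : ℝ) < n := by exact_mod_cast hn
  have hm' : (0 : ℝ) < m := by exact_mod_cast hm
  have hd : 0 < 1 - lam ^ 2 := by nlinarith
  rw [alphaBar]
  split_ifs with h
  · simp only [lt_min_iff]
    refine ⟨⟨?_, ?_⟩, ?_, ?_⟩ <;> positivity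
  · have hl : 0 < lam := lt_of_le_of_ne h0 (Ne.symm h)
    simp only [lt_min_iff]
    refine ⟨⟨?_, ?_⟩, ⟨?_, ⟨?_, ?_⟩, ?_, ?_⟩⟩ <;> positivity

theorem one_le_max_Qopt_Qnet (hm : 0 < m) (κ : ℝ) : 1 ≤ max (Qopt n m κ) (Qnet n κ lam) := by
  have hm' : (1 : ℝ) ≤ m := by exact_mod_cast hm
  exact le_max_of_le_left (le_max_of_le_right (le_max_of_le_right hm'))

/-- Each term of the minimum is at least `1 / (388 * μ * Q)`: 388 is the largest numerical constant,
`1 - lam ≤ 1 - lam ^ 2`, and every term matches one in `Qopt` or `Qnet`. -/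
theorem one_div_mul_alphaBar_le (hn : 0 < n) (hm : 0 < m) (hL : 0 < L) (hμ : 0 < μ)
    (h0 : 0 ≤ lam) (h1 : lam < 1) :
    1 / (μ * alphaBar n m L μ lam) ≤ 388 * max (Qopt n m (L / μ)) (Qnet n (L / μ) lam) := by
  have hn' : (0 : ℝ) < n := by exact_mod_cast hn
  have hm' : (0 : ℝ) < m := by exact_mod_cast hm
  have hd : 1 - lam ≤ 1 - lam ^ 2 := by nlinarith
  have hl1 : 0 < 1 - lam := by linarith
  have hpos := alphaBar_pos hn hm hL hμ h0 h1
  have hQ1 := one_le_max_Qopt_Qnet (n := n) (lam := lam) hm (L / μ)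
  set Q := max (Qopt n m (L / μ)) (Qnet n (L / μ) lam) with hQ
  have hκ : 0 < L / μ := by positivity
  have q : Qopt n m (L / μ) ≤ Q ∧ Qnet n (L / μ) lam ≤ Q := ⟨le_max_left _ _, le_max_right _ _⟩
  simp only [Qopt, Qnet, max_le_iff] at q
  obtain ⟨⟨q1, q2, q3⟩, ⟨q4, q5⟩, q6, q7⟩ := q
  have hLκ : L = L / μ * μ := by field_simp
  generalize L / μ = κ at *
  subst hLκ
  have hQ0 : 0 < Q := by linarith
  rw [div_le_iff₀ (by positivity)] at q1 q4 q5 q6 q7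
  have key : 1 / (388 * μ * Q) ≤ alphaBar n m (κ * μ) μ lam := by
    have hb : 1 / (388 * μ * Q) ≤ min (min ((n : ℝ) ^ (1 / 3 : ℝ) /
        (10.5 * (m : ℝ) ^ (2 / 3 : ℝ) * (κ * μ / μ) ^ (1 / 3 : ℝ) * (κ * μ))) (1 / (36 * (κ * μ))))
        (min ((1 - lam ^ 2) / (2 * μ)) (1 / (4 * m * μ))) := by
      rw [mul_div_cancel_right₀ _ hμ.ne']
      simp only [le_min_iff]
      refine ⟨⟨?_, ?_⟩, ?_, ?_⟩
      · rw [div_le_div_iff₀ (by positivity) (by positivity)]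
        have e : κ ^ (4 / 3 : ℝ) = κ * κ ^ (1 / 3 : ℝ) := by
          rw [← Real.rpow_one_add' hκ.le (by norm_num)]; norm_num
        rw [e] at q1
        have := mul_le_mul_of_nonneg_left q1 hμ.le
        have h2 : 0 ≤ μ * ((m : ℝ) ^ (2 / 3 : ℝ) * (κ * κ ^ (1 / 3 : ℝ))) := by positivity
        linarith
      · rw [div_le_div_iff₀ (by positivity) (by positivity)]
        nlinarith
      · rw [div_le_div_iff₀ (by positivity) (by positivity)]
        have : 1 ≤ Q * (1 - lam ^ 2) := q7.trans (by gcongr)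
        nlinarith
      · rw [div_le_div_iff₀ (by positivity) (by positivity)]
        nlinarith
    rw [alphaBar]
    split_ifs with h
    · exact hb
    · have hl : 0 < lam := lt_of_le_of_ne h0 (Ne.symm h)
      refine le_min (le_min ?_ ?_) (le_min ?_ hb)
      · rw [div_le_div_iff₀ (by positivity) (by positivity)]
        have h3 : lam * κ ≤ Q * (1 - lam ^ 2) ^ 2 := q4.trans (by gcongr)
        have := mul_le_mul_of_nonneg_left h3 hμ.le
        have h2 : 0 ≤ μ * (lam * κ) := by positivity
        linarith
      · rw [mul_div_cancel_right₀ _ hμ.ne']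
        have e : κ ^ (5 / 4 : ℝ) = κ * κ ^ (1 / 4 : ℝ) := by
          rw [← Real.rpow_one_add' hκ.le (by norm_num)]; norm_num
        rw [e] at q5
        rw [div_le_div_iff₀ (by positivity) (by positivity)]
        have h3 : lam * (κ * κ ^ (1 / 4 : ℝ)) ≤ Q * (1 - lam ^ 2) := q5.trans (by gcongr)
        have := mul_le_mul_of_nonneg_left h3 hμ.le
        have h2 : 0 ≤ μ * (lam * (κ * κ ^ (1 / 4 : ℝ))) := by positivity
        linarith
      · rw [div_le_div_iff₀ (by positivity) (by positivity)]
        have h3 : lam ^ 2 * n * κ ≤ Q * (1 - lam ^ 2) ^ 3 := q6.trans (by gcongr)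
        have := mul_le_mul_of_nonneg_left h3 hμ.le
        linarith
  rw [div_le_iff₀ (by positivity)] at key ⊢
  linarith

end StepSize

/-! ### Errors dominated by the Lyapunov function -/

section ErrorBounds

variable {n m p : ℕ} [NeZero n] [NeZero m] {f : Fin n → Fin m → Vec p → ℝ} {L α : ℝ}
  {W : Matrix (Fin n) (Fin n) ℝ}

theorem lyapunov_nonneg (hf : IsSmooth f L) {A B C : ℝ} (hA : 0 < A) (hB : 0 < B) (hC : 0 ≤ C)
    (S : NetState n m p) : 0 ≤ lyapunov f A B C S := by
  have p1 := gapErr_nonneg hf S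
  have p2 := consErr_nonneg S
  have p3 := tableErr_nonneg S
  have p4 := trackErr_nonneg (f := f) S
  rw [lyapunov]
  positivity

theorem exists_le_mul_lyapunov (hf : IsSmooth f L) (hW : IsWeight W) {A B C : ℝ} (hA : 0 < A)
    (hB : 0 < B) (hC : 0 ≤ C) : ∃ K : ℝ, 0 < K ∧ ∀ S : NetState n m p,
      mean (fun i => globalF f (S.x i) - optVal f) ≤ K * lyapunov f A B C S ∧
      consErr S ≤ K * lyapunov f A B C S ∧ gapErr f S ≤ K * lyapunov f A B C S ∧
      (Tracking S → stepMean f W α (fun S' => ‖mean S'.x - mean S.x‖ ^ 2) S ≤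
        K * lyapunov f A B C S) := by
  have hL := hf.L_pos
  have hn : (1 : ℝ) ≤ n := by exact_mod_cast NeZero.one_le
  refine ⟨1 + L / 2 / A + 1 / A + α ^ 2 * (4 * L + 4 * L ^ 2 / A + 2 * L ^ 2 / B),
    by positivity, fun S => ?_⟩
  have p1 := gapErr_nonneg hf S
  have p2 := consErr_nonneg S
  have p3 := tableErr_nonneg S
  have p4 := trackErr_nonneg (f := f) S
  have hΦ := lyapunov_nonneg hf hA hB hC S
  have hD : gapErr f S ≤ lyapunov f A B C S := by
    have : 0 ≤ A * consErr S + B * tableErr S + C * trackErr f S := by positivity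
    rw [lyapunov]; linarith
  have hX : consErr S ≤ 1 / A * lyapunov f A B C S := by
    have : 0 ≤ gapErr f S + B * tableErr S + C * trackErr f S := by positivity
    rw [one_div, inv_mul_eq_div, le_div_iff₀ hA, lyapunov]; linarith
  have hT : tableErr S ≤ 1 / B * lyapunov f A B C S := by
    have : 0 ≤ gapErr f S + A * consErr S + C * trackErr f S := by positivity
    rw [one_div, inv_mul_eq_div, le_div_iff₀ hB, lyapunov]; linarith
  set Φ := lyapunov f A B C S
  have w0 : 0 ≤ 1 / A * Φ := by positivity
  have w1 : 0 ≤ L / 2 / A * Φ := by positivity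
  have w2 : 0 ≤ α ^ 2 * (4 * L + 4 * L ^ 2 / A + 2 * L ^ 2 / B) * Φ := by positivity
  refine ⟨?_, ?_, ?_, fun hS => ?_⟩
  · have h1 : _ ≤ globalF f (mean S.x) + L / 2 * msq (dev S.x) := hf.mean_gap_le S.x
    have h2 : mean (fun i => globalF f (S.x i) - optVal f) ≤ gapErr f S + L / 2 * consErr S := by
      rw [mean_sub, mean_const]
      simp only [gapErr, consErr]
      linarith
    have h3 : L / 2 * consErr S ≤ L / 2 * (1 / A * Φ) := by gcongr
    have h4 : L / 2 * (1 / A * Φ) = L / 2 / A * Φ := by ring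
    linarith
  · linarith
  · linarith
  · rw [stepMean_move hf hW hS]
    have h1 := norm_gradient_sub_mean_localGrad_sq_le hf S.x
    have h2 := hf.norm_gradient_sq_le (mean S.x)
    -- The mean local gradient is compared with the gradient at the average point, whose square is
    -- at most `2 * L` times the gap.
    have h3 : ‖mean (localGrad f S.x)‖ ^ 2 ≤ 4 * L * gapErr f S + 2 * L ^ 2 * consErr S := by
      have h4 := norm_add_sq_le_young (gradient (globalF f) (mean S.x))
        (mean (localGrad f S.x) - gradient (globalF f) (mean S.x)) one_pos
      rw [add_sub_cancel] at h4
      rw [norm_sub_rev] at h1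
      norm_num at h4
      rw [gapErr, consErr]
      linarith
    have h5 : noiseVar f S / n ≤ 2 * L ^ 2 * (consErr S + tableErr S) :=
      (div_le_self (noiseVar_nonneg S) hn).trans (noiseVar_le hf S)
    have h6 : ‖mean (localGrad f S.x)‖ ^ 2 + noiseVar f S / n ≤
        4 * L * Φ + 4 * L ^ 2 * (1 / A * Φ) + 2 * L ^ 2 * (1 / B * Φ) := by
      have g1 : 4 * L * gapErr f S ≤ 4 * L * Φ := by gcongr
      have g2 : 4 * L ^ 2 * consErr S ≤ 4 * L ^ 2 * (1 / A * Φ) := by gcongr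
      have g3 : 2 * L ^ 2 * tableErr S ≤ 2 * L ^ 2 * (1 / B * Φ) := by gcongr
      linarith
    have h7 := mul_le_mul_of_nonneg_left h6 (sq_nonneg α)
    have h8 : α ^ 2 * (4 * L * Φ + 4 * L ^ 2 * (1 / A * Φ) + 2 * L ^ 2 * (1 / B * Φ)) =
        α ^ 2 * (4 * L + 4 * L ^ 2 / A + 2 * L ^ 2 / B) * Φ := by ring
    linarith

end ErrorBounds

/-! ### From averages over indices to expectations -/

section Sampling

variable {n m p : ℕ} {f : Fin n → Fin m → Vec p → ℝ} {W : Matrix (Fin n) (Fin n) ℝ} {α : ℝ}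
  {x0 : Vec p}

theorem netState_congr {k : ℕ} {t t' r r' : ℕ → Fin n → Fin m} (ht : ∀ l < k, t l = t' l)
    (hr : ∀ l < k, r l = r' l) :
    netState f W α x0 t r k = netState f W α x0 t' r' k := by
  induction k with
  | zero => rfl
  | succ k ih =>
    simp only [netState]
    rw [ih (fun l hl => ht l (by omega)) (fun l hl => hr l (by omega)), ht k (by omega),
      hr k (by omega)]

variable {Ω : Type*} {τ s : ℕ → Fin n → Ω → Fin m}

variable (f W α x0 τ s) in
/-- The random state of the network at the start of iteration `k`. -/
def run (k : ℕ) (ω : Ω) : NetState n m p :=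
  netState f W α x0 (fun k i => τ k i ω) (fun k i => s k i ω) k

/-- All the sampled indices as one family. -/
def sample (τ s : ℕ → Fin n → Ω → Fin m) (q : (ℕ × Fin n) ⊕ (ℕ × Fin n)) : Ω → Fin m :=
  Sum.elim (fun a => τ a.1 a.2) (fun a => s a.1 a.2) q

/-- The labels of the indices sampled at the times in `I`. -/
def labels (n : ℕ) (I : Finset ℕ) : Finset ((ℕ × Fin n) ⊕ (ℕ × Fin n)) :=
  (I ×ˢ Finset.univ).disjSum (I ×ˢ Finset.univ)

theorem disjoint_labels {I J : Finset ℕ} (h : Disjoint I J) :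
    Disjoint (labels n I) (labels n J) := by
  rw [Finset.disjoint_left] at h ⊢
  rintro (⟨l, i⟩ | ⟨l, i⟩) h1 h2 <;> simp [labels] at h1 h2 <;> exact h h1 h2

/-- The state is a function of the indices sampled before. -/
theorem exists_run_eq [NeZero m] {E : Type*} (φ : NetState n m p → E) (k : ℕ) :
    ∃ G : (labels n (Finset.range k) → Fin m) → E, ∀ (τ s : ℕ → Fin n → Ω → Fin m) (ω : Ω),
      φ (run f W α x0 τ s k ω) = G fun q => sample τ s q ω := by
  -- The default index 0 is used only at times from `k` on, which the first `k` iterations never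
  -- read.
  refine ⟨fun v => φ (netState f W α x0
    (fun l i => if h : Sum.inl (l, i) ∈ labels n (Finset.range k) then v ⟨_, h⟩ else 0)
    (fun l i => if h : Sum.inr (l, i) ∈ labels n (Finset.range k) then v ⟨_, h⟩ else 0) k),
    fun τ s ω => ?_⟩
  simp only [run]
  congr 1
  refine netState_congr (fun l hl => ?_) (fun l hl => ?_)
  · ext1 i
    have h : Sum.inl (l, i) ∈ labels n (Finset.range k) := by simp [labels, hl]
    rw [dif_pos h]
    rfl
  · ext1 i
    have h : Sum.inr (l, i) ∈ labels n (Finset.range k) := by simp [labels, hl]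
    rw [dif_pos h]
    rfl

variable [MeasurableSpace Ω] {P : Measure Ω}

theorem IsSampling.measurable_sample (h : IsSampling P τ s) (q : (ℕ × Fin n) ⊕ (ℕ × Fin n)) :
    Measurable (sample τ s q) := by
  rcases q with ⟨l, i⟩ | ⟨l, i⟩
  · exact h.measurable_tau l i
  · exact h.measurable_s l i

theorem IsSampling.measurable_run [NeZero m] (h : IsSampling P τ s) {E : Type*}
    [MeasurableSpace E] (φ : NetState n m p → E) (k : ℕ) :
    Measurable fun ω => φ (run f W α x0 τ s k ω) := by
  obtain ⟨G, hG⟩ := exists_run_eq (Ω := Ω) (f := f) (W := W) (α := α) (x0 := x0) φ k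
  simp only [hG]
  exact (measurable_of_finite G).comp (measurable_pi_lambda _ fun q => h.measurable_sample q)

theorem IsSampling.real_sample_eq (h : IsSampling P τ s) (k : ℕ) (t r : Fin n → Fin m) :
    P.real {ω | (∀ i, τ k i ω = t i) ∧ ∀ i, s k i ω = r i} = ((m : ℝ)⁻¹ ^ n) * ((m : ℝ)⁻¹ ^ n) := by
  have h1 := h.indep.measure_inter_preimage_eq_mul (labels n {k})
    (sets := fun q => {Sum.elim (fun a => t a.2) (fun a => r a.2) q})
    fun q _ => MeasurableSet.singleton _
  have h2 : {ω | (∀ i, τ k i ω = t i) ∧ ∀ i, s k i ω = r i} = ⋂ q ∈ labels n {k},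
      (Sum.elim (fun a => τ a.1 a.2) (fun a => s a.1 a.2) q) ⁻¹'
        {Sum.elim (fun a : ℕ × Fin n => t a.2) (fun a => r a.2) q} := by
    ext ω
    simp [labels]
  rw [Measure.real, h2, h1, labels, Finset.prod_disjSum, Finset.prod_product, Finset.prod_product,
    Finset.prod_singleton, Finset.prod_singleton, ENNReal.toReal_mul, ENNReal.toReal_prod,
    ENNReal.toReal_prod]
  congr 1
  · exact (Finset.prod_congr rfl fun i _ => (h.uniform_tau k i (t i)).trans (one_div _)).trans
      (by simp)
  · exact (Finset.prod_congr rfl fun i _ => (h.uniform_s k i (r i)).trans (one_div _)).trans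
      (by simp)

variable [IsProbabilityMeasure P]

theorem IsSampling.integrable_run [NeZero m] (h : IsSampling P τ s)
    (φ : NetState n m p → ℝ) (k : ℕ) :
    Integrable (fun ω => φ (run f W α x0 τ s k ω)) P := by
  obtain ⟨G, hG⟩ := exists_run_eq (Ω := Ω) (f := f) (W := W) (α := α) (x0 := x0) φ k
  simp only [hG]
  have hm : Measurable fun ω => fun q : labels n (Finset.range k) => sample τ s q ω :=
    measurable_pi_lambda _ fun q => h.measurable_sample q
  have : IsProbabilityMeasure (P.map fun ω => fun q : labels n (Finset.range k) =>
    sample τ s q ω) := Measure.isProbabilityMeasure_map hm.aemeasurable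
  exact (Integrable.of_finite (f := G)).comp_measurable hm

/-- Averaging over the indices of one iteration. -/
theorem IsSampling.integral_run_succ [NeZero m] (h : IsSampling P τ s)
    (φ : NetState n m p → NetState n m p → ℝ) (k : ℕ) :
    ∫ ω, φ (run f W α x0 τ s k ω) (run f W α x0 τ s (k + 1) ω) ∂P =
      ∫ ω, stepMean f W α (φ (run f W α x0 τ s k ω)) (run f W α x0 τ s k ω) ∂P := by
  classical
  let ind : (Fin n → Fin m) → (Fin n → Fin m) → Ω → ℝ := fun t r =>
    {ω | (∀ i, τ k i ω = t i) ∧ ∀ i, s k i ω = r i}.indicator 1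
  have hms : ∀ t r : Fin n → Fin m,
      MeasurableSet {ω | (∀ i, τ k i ω = t i) ∧ ∀ i, s k i ω = r i} := by
    intro t r
    simp only [Set.ofPred_and, Set.ofPred_forall]
    refine MeasurableSet.inter (MeasurableSet.iInter fun i => ?_) (MeasurableSet.iInter fun i => ?_)
    · exact h.measurable_tau k i (MeasurableSet.singleton _)
    · exact h.measurable_s k i (MeasurableSet.singleton _)
  -- Splitting by the values of the current indices leaves a finite sum of an indicator times a
  -- function of the past; the two are independent and the indicator has mean `m⁻¹ ^ n * m⁻¹ ^ n`.
  have hpt : ∀ ω, φ (run f W α x0 τ s k ω) (run f W α x0 τ s (k + 1) ω) =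
      ∑ t, ∑ r, ind t r ω * φ (run f W α x0 τ s k ω) (netStep f W α t r (run f W α x0 τ s k ω)) := by
    intro ω
    rw [Finset.sum_eq_single (fun i => τ k i ω), Finset.sum_eq_single (fun i => s k i ω)]
    · simp [ind, run, netState]
    · intro r _ hr
      have : ¬ ∀ i, s k i ω = r i := fun h => hr (funext fun i => (h i).symm)
      simp [ind, this]
    · simp
    · intro t _ ht
      have : ¬ ∀ i, τ k i ω = t i := fun h => ht (funext fun i => (h i).symm)
      simp [ind, this]
    · simp
  have hindep : ∀ t r, IndepFun (ind t r)
      (fun ω => φ (run f W α x0 τ s k ω) (netStep f W α t r (run f W α x0 τ s k ω))) P := by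
    intro t r
    obtain ⟨G, hG⟩ := exists_run_eq (Ω := Ω) (f := f) (W := W) (α := α) (x0 := x0)
      (fun S => φ S (netStep f W α t r S)) k
    have hI := h.indep.indepFun_finset (labels n {k}) (labels n (Finset.range k))
      (disjoint_labels (by simp)) h.measurable_sample
    let J : (labels n {k} → Fin m) → ℝ := fun v =>
      if (∀ i, v ⟨Sum.inl (k, i), by simp [labels]⟩ = t i) ∧
        ∀ i, v ⟨Sum.inr (k, i), by simp [labels]⟩ = r i then 1 else 0
    have h1 := hI.comp (measurable_of_finite J) (measurable_of_finite G)
    have e1 : ind t r = J ∘ fun a i => sample τ s i a := by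
      ext ω
      simp only [ind, J, sample, Set.indicator_apply, Set.mem_ofPred_eq, Function.comp_apply]
      congr
    have e2 : (fun ω => φ (run f W α x0 τ s k ω) (netStep f W α t r (run f W α x0 τ s k ω))) =
        G ∘ fun a i => sample τ s i a := funext fun ω => hG τ s ω
    rw [e1, e2]
    exact h1
  have hint : ∀ t r, Integrable
      (fun ω => ind t r ω * φ (run f W α x0 τ s k ω) (netStep f W α t r (run f W α x0 τ s k ω))) P := by
    intro t r
    refine (h.integrable_run (f := f) (W := W) (α := α) (x0 := x0)
      (fun S => φ S (netStep f W α t r S)) k).bdd_mul (c := 1)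
      ((measurable_one.indicator (hms t r)).aestronglyMeasurable) (.of_forall fun ω => ?_)
    by_cases hω : ω ∈ {ω | (∀ i, τ k i ω = t i) ∧ ∀ i, s k i ω = r i}
    · simp [ind, Set.indicator_of_mem hω]
    · simp [ind, Set.indicator_of_notMem hω]
  have hmul : ∀ t r, ∫ ω, ind t r ω *
      φ (run f W α x0 τ s k ω) (netStep f W α t r (run f W α x0 τ s k ω)) ∂P =
      ((m : ℝ)⁻¹ ^ n * (m : ℝ)⁻¹ ^ n) *
        ∫ ω, φ (run f W α x0 τ s k ω) (netStep f W α t r (run f W α x0 τ s k ω)) ∂P := by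
    intro t r
    rw [(hindep t r).integral_fun_mul_eq_mul_integral
      ((measurable_one.indicator (hms t r)).aestronglyMeasurable)
      (h.integrable_run (f := f) (W := W) (α := α) (x0 := x0)
        (fun S => φ S (netStep f W α t r S)) k).aestronglyMeasurable,
      integral_indicator_one (hms t r), h.real_sample_eq]
  simp only [hpt]
  rw [integral_finsetSum _ fun t _ => integrable_finsetSum _ fun r _ => hint t r]
  simp only [integral_finsetSum _ fun r _ => hint _ r, hmul]
  simp only [stepMean, mean, smul_eq_mul]
  rw [integral_const_mul, integral_finsetSum _ fun t _ => Integrable.const_mul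
    (integrable_finsetSum _ fun r _ => h.integrable_run (fun S => φ S (netStep f W α t r S)) k) _]
  have e : ∀ t, ∫ ω, ∑ r, φ (run f W α x0 τ s k ω) (netStep f W α t r (run f W α x0 τ s k ω)) ∂P =
      ∑ r, ∫ ω, φ (run f W α x0 τ s k ω) (netStep f W α t r (run f W α x0 τ s k ω)) ∂P := fun t =>
    integral_finsetSum _ fun r _ => h.integrable_run (fun S => φ S (netStep f W α t r S)) k
  simp only [integral_const_mul, e]
  simp [Finset.mul_sum, mul_assoc]

end Sampling

/-! ### Limits of processes with geometric mean square decay -/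

section MeanSquareLimit

open Filter Topology

variable {Ω E : Type*} [MeasurableSpace Ω] {P : Measure Ω} [NormedAddCommGroup E]

theorem eLpNorm_two_eq_sqrt_integral {g : Ω → E} (hg : MemLp g 2 P) :
    eLpNorm g 2 P = ENNReal.ofReal (Real.sqrt (∫ ω, ‖g ω‖ ^ 2 ∂P)) := by
  rw [hg.eLpNorm_eq_integral_rpow_norm two_ne_zero ENNReal.ofNat_ne_top, Real.sqrt_eq_rpow]
  simp

/-- Minkowski's inequality: the increments have `L²` norm at most `√K * s ^ k`, and their geometric
tail is summed. -/
theorem eLpNorm_sub_le_of_geometric {X : ℕ → Ω → E} (hX : ∀ k, MemLp (X k) 2 P) {K s : ℝ}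
    (hK : 0 ≤ K) (hs0 : 0 < s) (hs1 : s < 1)
    (hstep : ∀ k, ∫ ω, ‖X (k + 1) ω - X k ω‖ ^ 2 ∂P ≤ K * (s ^ 2) ^ k) (k j : ℕ) :
    eLpNorm (X (k + j) - X k) 2 P ≤ ENNReal.ofReal (Real.sqrt K / (1 - s) * s ^ k) := by
  have h1s : 0 < 1 - s := by linarith
  set c := Real.sqrt K / (1 - s) with hc
  have hc0 : 0 ≤ c := by positivity
  -- The telescoping bound is stronger than the goal, so that the induction on `j` closes.
  have key : eLpNorm (X (k + j) - X k) 2 P ≤ ENNReal.ofReal (c * (s ^ k - s ^ (k + j))) := by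
    induction j with
    | zero => simp
    | succ j ih =>
      have e : X (k + (j + 1)) - X k = (X (k + j + 1) - X (k + j)) + (X (k + j) - X k) := by
        rw [sub_add_sub_cancel]; rfl
      have h1 : eLpNorm (X (k + j + 1) - X (k + j)) 2 P ≤
          ENNReal.ofReal (Real.sqrt K * s ^ (k + j)) := by
        rw [eLpNorm_two_eq_sqrt_integral ((hX _).sub (hX _))]
        refine ENNReal.ofReal_le_ofReal ((Real.sqrt_le_sqrt (hstep (k + j))).trans (le_of_eq ?_))
        rw [Real.sqrt_mul hK, ← pow_mul, mul_comm 2, pow_mul, Real.sqrt_sq (by positivity)]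
      have h2 : s ^ (k + j) ≤ s ^ k := pow_le_pow_of_le_one hs0.le hs1.le (by omega)
      rw [e]
      refine (eLpNorm_add_le ((hX _).sub (hX _)).1 ((hX _).sub (hX _)).1 (by norm_num)).trans
        ((add_le_add h1 ih).trans (le_of_eq ?_))
      rw [← ENNReal.ofReal_add (by positivity) (mul_nonneg hc0 (sub_nonneg.2 h2))]
      congr 1
      have hcK : Real.sqrt K = c * (1 - s) := by rw [hc]; field_simp
      rw [hcK, ← add_assoc k j 1, pow_succ s (k + j)]
      ring
  refine key.trans (ENNReal.ofReal_le_ofReal ?_)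
  have : 0 ≤ c * s ^ (k + j) := by positivity
  nlinarith

/-- A process whose increments decay geometrically in mean square converges, almost surely and
geometrically in mean square. -/
theorem exists_limit_of_geometric [CompleteSpace E] [MeasurableSpace E] [BorelSpace E]
    [SecondCountableTopology E] {X : ℕ → Ω → E} (hX : ∀ k, MemLp (X k) 2 P) {K r : ℝ}
    (hK : 0 ≤ K) (hr0 : 0 < r) (hr1 : r < 1)
    (hstep : ∀ k, ∫ ω, ‖X (k + 1) ω - X k ω‖ ^ 2 ∂P ≤ K * r ^ k) :
    ∃ Y : Ω → E, Measurable Y ∧ (∀ᵐ ω ∂P, Tendsto (fun k => X k ω) atTop (𝓝 (Y ω))) ∧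
      ∃ C : ℝ, 0 ≤ C ∧ ∀ k, Integrable (fun ω => ‖X k ω - Y ω‖ ^ 2) P ∧
        ∫ ω, ‖X k ω - Y ω‖ ^ 2 ∂P ≤ C * r ^ k := by
  obtain ⟨s, hs0, hs⟩ : ∃ s : ℝ, 0 < s ∧ s ^ 2 = r :=
    ⟨Real.sqrt r, Real.sqrt_pos.2 hr0, Real.sq_sqrt hr0.le⟩
  subst hs
  have hs1 : s < 1 := by nlinarith
  have h1s : 0 < 1 - s := by linarith
  have hdist := eLpNorm_sub_le_of_geometric hX hK hs0 hs1 hstep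
  set c := Real.sqrt K / (1 - s) with hc
  have hc0 : 0 ≤ c := by positivity
  have hle : ∀ N k l, N ≤ k → k ≤ l → eLpNorm (X l - X k) 2 P ≤ ENNReal.ofReal (c * s ^ N) := by
    intro N k l hN hkl
    obtain ⟨j, rfl⟩ := Nat.exists_eq_add_of_le hkl
    refine (hdist k j).trans (ENNReal.ofReal_le_ofReal ?_)
    have : s ^ k ≤ s ^ N := pow_le_pow_of_le_one hs0.le hs1.le hN
    gcongr
  have hlim : ∀ᵐ ω ∂P, ∃ l : E, Tendsto (fun k => X k ω) atTop (𝓝 l) := by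
    -- The constant is raised to `c + 1` because the criterion asks for strict inequalities.
    refine Lp.ae_tendsto_of_cauchy_eLpNorm (p := 2) (fun k => (hX k).1) (by norm_num)
      (B := fun N => ENNReal.ofReal ((c + 1) * s ^ N)) ?_ fun N k l hk hl => ?_
    · rw [← ENNReal.ofReal_tsum_of_nonneg (fun N => by positivity)
        ((summable_geometric_of_lt_one hs0.le hs1).mul_left _)]
      exact ENNReal.ofReal_ne_top
    · have hlt : ENNReal.ofReal (c * s ^ N) < ENNReal.ofReal ((c + 1) * s ^ N) := by
        have : 0 < s ^ N := by positivity
        rw [ENNReal.ofReal_lt_ofReal_iff (by positivity)]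
        linarith
      refine lt_of_le_of_lt ?_ hlt
      rcases le_total k l with h | h
      · rw [eLpNorm_sub_comm]
        exact hle N k l hk h
      · exact hle N l k hl h
  obtain ⟨Y, hYm, hY⟩ := measurable_limit_of_tendsto_metrizable_ae
    (fun k => (hX k).1.aemeasurable) hlim
  refine ⟨Y, hYm, hY, c ^ 2, sq_nonneg _, fun k => ?_⟩
  have hYk : eLpNorm (X k - Y) 2 P ≤ ENNReal.ofReal (c * s ^ k) := by
    rw [eLpNorm_sub_comm]
    -- Fatou's lemma carries the uniform bound on the later differences to the almost sure limit.
    refine Lp.eLpNorm_le_of_ae_tendsto (u := atTop) (f := fun l => X l - X k)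
      ((eventually_ge_atTop k).mono fun l hl => hle k k l le_rfl hl)
      (fun l => ((hX l).sub (hX k)).1) ?_
    filter_upwards [hY] with ω hω
    exact hω.sub_const (X k ω)
  have hmem : MemLp (X k - Y) 2 P :=
    ⟨(hX k).1.sub hYm.aestronglyMeasurable, hYk.trans_lt ENNReal.ofReal_lt_top⟩
  have hint : Integrable (fun ω => ‖(X k - Y) ω‖ ^ 2) P :=
    (memLp_two_iff_integrable_sq_norm hmem.1).1 hmem
  refine ⟨hint, ?_⟩
  rw [eLpNorm_two_eq_sqrt_integral hmem, ENNReal.ofReal_le_ofReal_iff (by positivity)] at hYk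
  have h2 := (Real.sqrt_le_left (by positivity)).1 hYk
  calc _ ≤ _ := h2
    _ = _ := by ring

/-- A nonnegative process whose expectations decay geometrically has no nonzero limit. -/
theorem limit_eq_zero_of_geometric {h : ℕ → Ω → ℝ} {g : Ω → ℝ} (hh : ∀ k, Integrable (h k) P)
    (h0 : ∀ k ω, 0 ≤ h k ω) {K r : ℝ} (hK : 0 ≤ K) (hr0 : 0 < r) (hr1 : r < 1)
    (hle : ∀ k, ∫ ω, h k ω ∂P ≤ K * r ^ k)
    (hlim : ∀ᵐ ω ∂P, Tendsto (fun k => h k ω) atTop (𝓝 (g ω))) : ∀ᵐ ω ∂P, g ω = 0 := by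
  have hb : ∀ N, eLpNorm g 1 P ≤ ENNReal.ofReal (K * r ^ N) := by
    intro N
    refine Lp.eLpNorm_le_of_ae_tendsto (u := atTop) (f := h)
      ((eventually_ge_atTop N).mono fun k hk => ?_) (fun k => (hh k).1) hlim
    rw [eLpNorm_one_eq_lintegral_enorm, ← ofReal_integral_norm_eq_lintegral_enorm (hh k)]
    refine ENNReal.ofReal_le_ofReal ?_
    simp only [Real.norm_of_nonneg (h0 k _)]
    refine (hle k).trans ?_
    have : r ^ k ≤ r ^ N := pow_le_pow_of_le_one hr0.le hr1.le hk
    gcongr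
  have ht : Tendsto (fun N => ENNReal.ofReal (K * r ^ N)) atTop (𝓝 0) := by
    have h1 := (tendsto_pow_atTop_nhds_zero_of_lt_one hr0.le hr1).const_mul K
    rw [mul_zero] at h1
    simpa using ENNReal.tendsto_ofReal h1
  have hz : eLpNorm g 1 P = 0 := le_antisymm (ge_of_tendsto' ht hb) zero_le
  have hg : AEStronglyMeasurable g P :=
    aestronglyMeasurable_of_tendsto_ae _ (fun k => (hh k).1) hlim
  exact (eLpNorm_eq_zero_iff hg one_ne_zero).1 hz

end MeanSquareLimit

/-! ### Convergence and iteration count -/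

section Convergence

variable {n m p : ℕ} [NeZero n] [NeZero m] {f : Fin n → Fin m → Vec p → ℝ} {L μ α : ℝ}
  {W : Matrix (Fin n) (Fin n) ℝ} {x0 : Vec p} {Ω : Type*} [MeasurableSpace Ω] {P : Measure Ω}
  [IsProbabilityMeasure P] {τ s : ℕ → Fin n → Ω → Fin m}

theorem tracking_run (hW : IsWeight W) (k : ℕ) (ω : Ω) : Tracking (run f W α x0 τ s k ω) := by
  induction k with
  | zero => simp [Tracking, run, netState]
  | succ k ih => exact Tracking.netStep _ _ hW ih

theorem gap_eq (k : ℕ) (ω : Ω) : gap f W α x0 τ s k ω =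
    mean fun i => globalF f ((run f W α x0 τ s k ω).x i) - optVal f := by
  simp [gap, mean, iter, run]

/-- All the errors of the iterates, and the mean square increments of their average, decay
geometrically in expectation. -/
theorem exists_errors_le (hf : IsSmooth f L) (hPL : IsPL f μ) (hW : IsWeight W)
    (hs : IsSampling P τ s) (hα : IsStep n m L μ (secondSV W) α) (hr0 : 0 < 1 - μ * α / 2) :
    ∃ K : ℝ, 0 < K ∧ ∀ k,
      ∫ ω, gap f W α x0 τ s k ω ∂P ≤ K * (1 - μ * α / 2) ^ k ∧
      ∫ ω, consErr (run f W α x0 τ s k ω) ∂P ≤ K * (1 - μ * α / 2) ^ k ∧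
      ∫ ω, gapErr f (run f W α x0 τ s k ω) ∂P ≤ K * (1 - μ * α / 2) ^ k ∧
      ∫ ω, ‖mean (run f W α x0 τ s (k + 1) ω).x - mean (run f W α x0 τ s k ω).x‖ ^ 2 ∂P ≤
        K * (1 - μ * α / 2) ^ k := by
  obtain ⟨A, B, C, hA, hB, hC, hstep⟩ := exists_stepMean_lyapunov_le hf hPL hW hα
  obtain ⟨K, hK, hbound⟩ := exists_le_mul_lyapunov (α := α) hf hW hA hB hC
  set Φ := lyapunov f A B C
  set S0 : NetState n m p :=
    { x := fun _ => x0, y := fun _ => 0, z := fun _ _ => x0, g := fun _ => 0 }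
  have hΦ : ∀ k, ∫ ω, Φ (run f W α x0 τ s k ω) ∂P ≤ (1 - μ * α / 2) ^ k * Φ S0 := by
    intro k
    induction k with
    | zero => simp [run, netState, S0]
    | succ k ih =>
      rw [hs.integral_run_succ fun _ => Φ]
      have h1 : ∫ ω, stepMean f W α Φ (run f W α x0 τ s k ω) ∂P ≤
          ∫ ω, (1 - μ * α / 2) * Φ (run f W α x0 τ s k ω) ∂P :=
        integral_mono (hs.integrable_run _ k) ((hs.integrable_run _ k).const_mul _)
          fun ω => hstep _ (tracking_run hW k ω)
      rw [integral_const_mul] at h1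
      have h2 := mul_le_mul_of_nonneg_left ih hr0.le
      rw [pow_succ']
      linarith
  have hΦ0 : 0 ≤ Φ S0 := lyapunov_nonneg hf hA hB hC S0
  -- Adding 1 to the initial value keeps the constant positive even when the Lyapunov function
  -- starts at zero.
  have hmain : ∀ (φ : NetState n m p → ℝ) k, (∀ ω, φ (run f W α x0 τ s k ω) ≤
      K * Φ (run f W α x0 τ s k ω)) →
      ∫ ω, φ (run f W α x0 τ s k ω) ∂P ≤ K * (Φ S0 + 1) * (1 - μ * α / 2) ^ k := by
    intro φ k hφ
    have h1 : ∫ ω, φ (run f W α x0 τ s k ω) ∂P ≤ ∫ ω, K * Φ (run f W α x0 τ s k ω) ∂P :=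
      integral_mono (hs.integrable_run _ k) ((hs.integrable_run _ k).const_mul _) hφ
    rw [integral_const_mul] at h1
    have h2 := mul_le_mul_of_nonneg_left (hΦ k) hK.le
    have h3 : 0 < K * (1 - μ * α / 2) ^ k := by positivity
    linarith
  refine ⟨K * (Φ S0 + 1), by positivity, fun k => ⟨?_, ?_, ?_, ?_⟩⟩
  · simp only [gap_eq]
    exact hmain (fun S => mean fun i => globalF f (S.x i) - optVal f) k fun ω => (hbound _).1
  · exact hmain _ k fun ω => (hbound _).2.1
  · exact hmain _ k fun ω => (hbound _).2.2.1
  · rw [hs.integral_run_succ fun S S' => ‖mean S'.x - mean S.x‖ ^ 2]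
    exact hmain (fun S => stepMean f W α (fun S' => ‖mean S'.x - mean S.x‖ ^ 2) S) k
      fun ω => (hbound _).2.2.2 (tracking_run hW k ω)

theorem norm_sub_mean_sq_le (S : NetState n m p) (i : Fin n) :
    ‖S.x i - mean S.x‖ ^ 2 ≤ n * consErr S := by
  have := norm_sq_le_card_mul_msq (dev S.x) i
  rwa [Fintype.card_fin] at this

theorem integrable_gap (hs : IsSampling P τ s) (k : ℕ) :
    Integrable (gap f W α x0 τ s k) P := by
  have h : gap f W α x0 τ s k = fun ω => _ := funext fun ω => gap_eq k ω
  rw [h]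
  exact hs.integrable_run (fun S => mean fun i => globalF f (S.x i) - optVal f) k

theorem exists_minimizer (hf : IsSmooth f L) (hPL : IsPL f μ) (hW : IsWeight W)
    (hs : IsSampling P τ s) (hα : IsStep n m L μ (secondSV W) α) (hr0 : 0 < 1 - μ * α / 2) :
    ∃ (C : ℝ) (xstar : Ω → Vec p), Measurable xstar ∧
      (∀ᵐ ω ∂P, ∀ x, globalF f (xstar ω) ≤ globalF f x) ∧
      ∀ k : ℕ, ∫ ω, gap f W α x0 τ s k ω ∂P ≤ C * (1 - μ * α / 2) ^ k ∧
        ∀ i, Integrable (fun ω => ‖iter f W α x0 τ s k i ω - xstar ω‖ ^ 2) P ∧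
          ∫ ω, ‖iter f W α x0 τ s k i ω - xstar ω‖ ^ 2 ∂P ≤ C * (1 - μ * α / 2) ^ k := by
  obtain ⟨K, hK, hle⟩ := exists_errors_le (x0 := x0) hf hPL hW hs hα hr0
  have hr1 : 1 - μ * α / 2 < 1 := by
    have := mul_pos hPL.mu_pos hα.pos
    linarith
  set r := 1 - μ * α / 2
  have hX : ∀ k, MemLp (fun ω => mean (run f W α x0 τ s k ω).x) 2 P := fun k =>
    (memLp_two_iff_integrable_sq_norm
      (hs.measurable_run (fun S => mean S.x) k).aestronglyMeasurable).2
      (hs.integrable_run (fun S => ‖mean S.x‖ ^ 2) k)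
  obtain ⟨Y, hYm, hY, C, hC, hdist⟩ :=
    exists_limit_of_geometric hX hK.le hr0 hr1 fun k => (hle k).2.2.2
  -- By continuity the gaps at the average points tend to the gap at the limit, while their
  -- expectations tend to zero.
  have hmin : ∀ᵐ ω ∂P, globalF f (Y ω) - optVal f = 0 := by
    refine limit_eq_zero_of_geometric (h := fun k ω => gapErr f (run f W α x0 τ s k ω))
      (fun k => hs.integrable_run _ k) (fun k ω => gapErr_nonneg hf _) hK.le hr0 hr1
      (fun k => (hle k).2.2.1) ?_
    filter_upwards [hY] with ω hω
    exact ((hf.globalF.differentiable.continuous.tendsto _).comp hω).sub_const _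
  refine ⟨K + (2 * (n * K) + 2 * C), Y, hYm, ?_, fun k => ⟨?_, fun i => ?_⟩⟩
  · filter_upwards [hmin] with ω hω x
    have := hf.optVal_le x
    linarith
  · have h1 : 0 ≤ (2 * (n * K) + 2 * C) * r ^ k := by positivity
    have h2 := (hle k).1
    linarith
  · have hpt : ∀ ω, ‖iter f W α x0 τ s k i ω - Y ω‖ ^ 2 ≤
        2 * (n * consErr (run f W α x0 τ s k ω)) +
          2 * ‖mean (run f W α x0 τ s k ω).x - Y ω‖ ^ 2 := by
      intro ω
      have h1 := norm_sub_mean_sq_le (run f W α x0 τ s k ω) i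
      have h2 := norm_add_sq_le_young ((run f W α x0 τ s k ω).x i - mean (run f W α x0 τ s k ω).x)
        (mean (run f W α x0 τ s k ω).x - Y ω) one_pos
      rw [sub_add_sub_cancel] at h2
      norm_num at h2
      have h3 : iter f W α x0 τ s k i ω = (run f W α x0 τ s k ω).x i := rfl
      rw [h3]
      linarith
    have hi1 : Integrable (fun ω => 2 * (n * consErr (run f W α x0 τ s k ω))) P :=
      hs.integrable_run (fun S => 2 * (n * consErr S)) k
    have hi2 : Integrable (fun ω => 2 * ‖mean (run f W α x0 τ s k ω).x - Y ω‖ ^ 2) P :=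
      (hdist k).1.const_mul 2
    have hm : Measurable fun ω => ‖iter f W α x0 τ s k i ω - Y ω‖ ^ 2 :=
      (((hs.measurable_run (fun S => S.x i) k).sub hYm).norm).pow_const 2
    have hint : Integrable (fun ω => ‖iter f W α x0 τ s k i ω - Y ω‖ ^ 2) P :=
      (hi1.add hi2).mono' hm.aestronglyMeasurable
        (.of_forall fun ω => by rw [Real.norm_of_nonneg (sq_nonneg _)]; exact hpt ω)
    refine ⟨hint, (integral_mono hint (hi1.add hi2) hpt).trans ?_⟩
    simp only [Pi.add_apply]
    rw [integral_add hi1 hi2, integral_const_mul, integral_const_mul, integral_const_mul]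
    have h1 := mul_le_mul_of_nonneg_left (hle k).2.1 (Nat.cast_nonneg n : (0 : ℝ) ≤ n)
    have h2 := (hdist k).2
    have h3 : 0 ≤ K * r ^ k := by positivity
    linarith

theorem integral_iter_sub_iter_le (hs : IsSampling P τ s) (k : ℕ) (i l : Fin n) :
    Integrable (fun ω => ‖iter f W α x0 τ s k i ω - iter f W α x0 τ s k l ω‖ ^ 2) P ∧
      ∫ ω, ‖iter f W α x0 τ s k i ω - iter f W α x0 τ s k l ω‖ ^ 2 ∂P ≤
        4 * n * ∫ ω, consErr (run f W α x0 τ s k ω) ∂P := by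
  have hint : Integrable (fun ω => ‖iter f W α x0 τ s k i ω - iter f W α x0 τ s k l ω‖ ^ 2) P :=
    hs.integrable_run (fun S => ‖S.x i - S.x l‖ ^ 2) k
  refine ⟨hint, ?_⟩
  rw [← integral_const_mul]
  refine integral_mono hint (hs.integrable_run (fun S => 4 * n * consErr S) k) fun ω => ?_
  have h1 := norm_sub_mean_sq_le (run f W α x0 τ s k ω) i
  have h2 := norm_sub_mean_sq_le (run f W α x0 τ s k ω) l
  have h3 := norm_add_sq_le_young ((run f W α x0 τ s k ω).x i - mean (run f W α x0 τ s k ω).x)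
    (mean (run f W α x0 τ s k ω).x - (run f W α x0 τ s k ω).x l) one_pos
  rw [sub_add_sub_cancel] at h3
  rw [norm_sub_rev] at h2
  norm_num at h3
  change ‖(run f W α x0 τ s k ω).x i - (run f W α x0 τ s k ω).x l‖ ^ 2 ≤ _
  linarith

/-- The iteration count that makes a geometrically decaying error at most `ε`. -/
theorem exists_iterations {K β : ℝ} (hK : 0 < K) (hβ0 : 0 < β) (hβ1 : β < 1) :
    ∃ ε₀ : ℝ, 0 < ε₀ ∧ ∀ ε : ℝ, 0 < ε → ε ≤ ε₀ → ∃ N : ℕ,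
      1 ≤ Real.log (1 / ε) ∧ (N : ℝ) ≤ 2 / β * Real.log (1 / ε) + 1 ∧
      ∀ k : ℕ, N ≤ k → K * (1 - β) ^ k ≤ ε := by
  -- The first bound gives `log (1 / ε) ≥ 1`. The second lets accuracy `ε ^ 2` absorb `K`, so the
  -- iteration count is free of `K` at the price of the factor 2.
  refine ⟨min (Real.exp (-1)) (1 / K), by positivity, fun ε hε hle => ?_⟩
  have hl1 : 1 ≤ Real.log (1 / ε) := by
    rw [one_div, Real.log_inv]
    have := Real.log_le_log hε (hle.trans (min_le_left _ _))
    rw [Real.log_exp] at this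
    linarith
  have hKε : K * ε ≤ 1 := by
    have := hle.trans (min_le_right _ _)
    rw [le_div_iff₀ hK] at this
    linarith
  refine ⟨⌈2 / β * Real.log (1 / ε)⌉₊, hl1, (Nat.ceil_lt_add_one (by positivity)).le,
    fun k hk => ?_⟩
  have hk' := Nat.ceil_le.1 hk
  have h1 : (1 - β) ^ k ≤ ε ^ 2 := by
    calc (1 - β) ^ k ≤ Real.exp (-β) ^ k := by
          have := Real.add_one_le_exp (-β)
          exact pow_le_pow_left₀ (by linarith) (by linarith) k
      _ = Real.exp (-(β * k)) := by rw [← Real.exp_nat_mul]; ring_nf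
      _ ≤ Real.exp (2 * Real.log ε) := by
          have h2 : 2 * Real.log (1 / ε) ≤ β * k := by
            rw [div_mul_eq_mul_div, div_le_iff₀ hβ0] at hk'
            linarith
          rw [one_div, Real.log_inv] at h2
          exact Real.exp_le_exp.2 (by linarith)
      _ = ε ^ 2 := by rw [mul_comm, Real.exp_mul, Real.exp_log hε]; norm_num
  calc K * (1 - β) ^ k ≤ K * ε ^ 2 := by gcongr
    _ = K * ε * ε := by ring
    _ ≤ 1 * ε := by gcongr
    _ = ε := one_mul ε

end Convergence

/-! ### Reduction to centralized SAGA -/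

section Centralized

variable {n m p : ℕ} [NeZero n] {f : Fin n → Fin m → Vec p → ℝ}
  {W : Matrix (Fin n) (Fin n) ℝ}

/-- A contraction factor of zero annihilates all deviations, and the average is preserved. -/
theorem mix_eq_mean_of_secondSV_eq_zero (hW : IsWeight W) (h : secondSV W = 0)
    (u : Fin n → Vec p) : mix W u = fun _ => mean u := by
  have h1 := msq_mix_le hW _ (mean_dev u)
  rw [h, zero_pow two_ne_zero, zero_mul] at h1
  have h2 : mix W (dev u) = 0 := by
    ext1 i
    have h3 := norm_sq_le_card_mul_msq (mix W (dev u)) i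
    have h4 : (Fintype.card (Fin n) : ℝ) * msq (mix W (dev u)) ≤ 0 :=
      mul_nonpos_of_nonneg_of_nonpos (by positivity) h1
    have h5 : ‖mix W (dev u) i‖ ^ 2 = 0 := le_antisymm (h3.trans h4) (sq_nonneg _)
    simpa using h5
  have h3 : u = dev u + fun _ => mean u := by
    ext1 i
    simp [dev]
  rw [h3, mix_add, h2, mix_const hW, zero_add, ← h3]

/-- The third conjunct closes the induction: once every tracker equals the average estimator, mixing
cancels the old estimators and leaves the new average. -/
theorem netState_eq_centralSAGA (hW : IsWeight W) (h : secondSV W = 0) (α : ℝ) (x0 : Vec p)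
    (t r : ℕ → Fin n → Fin m) (k : ℕ) :
    (netState f W α x0 t r k).x = (fun _ => (centralSAGA f α x0 t r k).1) ∧
      (netState f W α x0 t r k).z = (centralSAGA f α x0 t r k).2 ∧
      (∀ i, (netState f W α x0 t r k).y i = mean (netState f W α x0 t r k).g) := by
  induction k with
  | zero => simp [netState, centralSAGA, mean]
  | succ k ih =>
    obtain ⟨hx, hz, hy⟩ := ih
    set S := netState f W α x0 t r k with hS
    set c := centralSAGA f α x0 t r k with hc
    have hg : (netStep f W α (t k) (r k) S).g =
        fun i => sagaEstimator (f i) c.1 (c.2 i) (t k i) := by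
      ext1 i
      simp only [netStep, hx, hz]
    have hyn : (netStep f W α (t k) (r k) S).y =
        fun _ => mean (netStep f W α (t k) (r k) S).g := by
      have e : (netStep f W α (t k) (r k) S).y =
          mix W (S.y + (netStep f W α (t k) (r k) S).g - S.g) := rfl
      have hmy : S.y = fun _ => mean S.g := funext hy
      have e2 : mean (S.y + (netStep f W α (t k) (r k) S).g - S.g) =
          mean S.y + mean (netStep f W α (t k) (r k) S).g - mean S.g := by
        rw [← mean_add, ← mean_sub]; rfl
      rw [e, mix_eq_mean_of_secondSV_eq_zero hW h, e2, hmy, mean_const]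
      ext1 i
      abel
    have hxn : (netStep f W α (t k) (r k) S).x =
        mix W (S.x - α • (netStep f W α (t k) (r k) S).y) := rfl
    refine ⟨?_, ?_, fun i => ?_⟩
    · change (netStep f W α (t k) (r k) S).x = _
      rw [hxn, hyn, mix_eq_mean_of_secondSV_eq_zero hW h, hx]
      have e3 : mean ((fun _ : Fin n => c.1) - α • fun _ : Fin n =>
          mean (netStep f W α (t k) (r k) S).g) =
          c.1 - α • mean (netStep f W α (t k) (r k) S).g :=
        mean_const (ι := Fin n) (c.1 - α • mean (netStep f W α (t k) (r k) S).g)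
      rw [e3, hg]
      simp [centralSAGA, mean, ← hc]
    · change (netStep f W α (t k) (r k) S).z = _
      ext1 i
      ext1 j
      simp only [netStep, centralSAGA, hx, hz, ← hc]
    · change (netStep f W α (t k) (r k) S).y i = mean (netStep f W α (t k) (r k) S).g
      rw [hyn]

end Centralized

end

end GTSAGA

open GTSAGA in
/-- The constant `c` is universal; `C` and `ε₀` may depend on the problem instance. -/
theorem theorem2 :
    ∃ c : ℝ, 0 < c ∧
      ∀ (n m p : ℕ) (_ : 0 < n) (_ : 0 < m)
        (f : Fin n → Fin m → Vec p → ℝ) (L μ : ℝ) (W : Matrix (Fin n) (Fin n) ℝ) (x0 : Vec p)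
        (Ω : Type*) [MeasurableSpace Ω] (P : Measure Ω) [IsProbabilityMeasure P]
        (τ s : ℕ → Fin n → Ω → Fin m),
        IsSmooth f L → IsPL f μ → 1 ≤ L / μ → IsWeight W → IsSampling P τ s →
        -- linear convergence of all nodes to a global minimizer, at rate `1 - μα/2`
        (∀ α : ℝ, 0 < α → α ≤ alphaBar n m L μ (secondSV W) →
          ∃ (C : ℝ) (xstar : Ω → Vec p), Measurable xstar ∧
            (∀ᵐ ω ∂P, ∀ x, globalF f (xstar ω) ≤ globalF f x) ∧
            ∀ k : ℕ,
              (Integrable (gap f W α x0 τ s k) P ∧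
                ∫ ω, gap f W α x0 τ s k ω ∂P ≤ C * (1 - μ * α / 2) ^ k) ∧
              ∀ i, Integrable (fun ω => ‖iter f W α x0 τ s k i ω - xstar ω‖ ^ 2) P ∧
                ∫ ω, ‖iter f W α x0 τ s k i ω - xstar ω‖ ^ 2 ∂P ≤ C * (1 - μ * α / 2) ^ k) ∧
        -- iteration complexity for the largest step size
        (∃ ε₀ : ℝ, 0 < ε₀ ∧ ∀ ε : ℝ, 0 < ε → ε ≤ ε₀ →
          ∃ K : ℕ,
            (K : ℝ) ≤ c * max (Qopt n m (L / μ)) (Qnet n (L / μ) (secondSV W)) *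
              Real.log (1 / ε) ∧
            ∀ k : ℕ, K ≤ k →
              (Integrable (gap f W (alphaBar n m L μ (secondSV W)) x0 τ s k) P ∧
                ∫ ω, gap f W (alphaBar n m L μ (secondSV W)) x0 τ s k ω ∂P ≤ ε) ∧
              ∀ i l,
                Integrable (fun ω => ‖iter f W (alphaBar n m L μ (secondSV W)) x0 τ s k i ω -
                  iter f W (alphaBar n m L μ (secondSV W)) x0 τ s k l ω‖ ^ 2) P ∧
                ∫ ω, ‖iter f W (alphaBar n m L μ (secondSV W)) x0 τ s k i ω -
                  iter f W (alphaBar n m L μ (secondSV W)) x0 τ s k l ω‖ ^ 2 ∂P ≤ ε) ∧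
        -- for `λ = 0` the method is centralized SAGA, and only `Q_opt` matters
        (secondSV W = 0 →
          (∀ (α : ℝ) (k : ℕ) (i : Fin n) (ω : Ω),
            iter f W α x0 τ s k i ω =
              (centralSAGA f α x0 (fun k i => τ k i ω) (fun k i => s k i ω) k).1) ∧
          max (Qopt n m (L / μ)) (Qnet n (L / μ) (secondSV W)) = Qopt n m (L / μ)) := by
  -- `1553 = 4 * 388 + 1`: the 4 is `2 / (μ * α / 2)` times `μ * α`, and the 1 pays for rounding up,
  -- as `Q` and the logarithm are at least one.
  refine ⟨1553, by norm_num, ?_⟩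
  intro n m p hn hm f L μ W x0 Ω _ P _ τ s hf hPL hκ hW hs
  have : NeZero n := ⟨hn.ne'⟩
  have : NeZero m := ⟨hm.ne'⟩
  have hL := hf.L_pos
  have hμ := hPL.mu_pos
  have h0 := secondSV_nonneg W
  have h1 := hW.secondSV_lt_one
  have hm1 : (1 : ℝ) ≤ m := by exact_mod_cast hm
  have hn0 : (0 : ℝ) < n := by exact_mod_cast hn
  have hstep : ∀ α : ℝ, 0 < α → α ≤ alphaBar n m L μ (secondSV W) →
      IsStep n m L μ (secondSV W) α := fun α =>
    isStep_of_le_alphaBar hn hm hL hμ hκ h0 h1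
  have hrate : ∀ α : ℝ, IsStep n m L μ (secondSV W) α → μ * α / 2 < 1 := by
    intro α hα
    have h2 : 1 / (8 * (m : ℝ)) < 1 := by
      rw [div_lt_one (by positivity)]
      linarith
    exact hα.rate_table.trans_lt h2
  refine ⟨fun α hα hle => ?_, ?_, fun hl => ⟨fun α k i ω => ?_, ?_⟩⟩
  · have hα' := hstep α hα hle
    obtain ⟨C, xstar, hmeas, hmin, hC⟩ :=
      exists_minimizer (x0 := x0) hf hPL hW hs hα' (sub_pos.2 (hrate α hα'))
    exact ⟨C, xstar, hmeas, hmin, fun k => ⟨⟨integrable_gap hs k, (hC k).1⟩, (hC k).2⟩⟩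
  · have hpos := alphaBar_pos hn hm hL hμ h0 h1
    have hQ := one_div_mul_alphaBar_le hn hm hL hμ h0 h1
    have hQ1 := one_le_max_Qopt_Qnet (n := n) (lam := secondSV W) hm (L / μ)
    have hα' := hstep _ hpos le_rfl
    generalize alphaBar n m L μ (secondSV W) = α at *
    generalize max (Qopt n m (L / μ)) (Qnet n (L / μ) (secondSV W)) = Q at *
    have hβ1 := hrate α hα'
    obtain ⟨K, hK, hle⟩ := exists_errors_le (x0 := x0) hf hPL hW hs hα' (sub_pos.2 hβ1)
    -- The constant covers both the gap, with `K`, and the pairwise distances of the nodes, with `4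
    -- * n * K`.
    obtain ⟨ε₀, hε₀, hN⟩ := exists_iterations (K := K + 4 * n * K) (β := μ * α / 2)
      (by positivity) (by positivity) hβ1
    refine ⟨ε₀, hε₀, fun ε hε hεle => ?_⟩
    obtain ⟨N, hlog, hNle, hk⟩ := hN ε hε hεle
    refine ⟨N, ?_, fun k hkN => ⟨⟨integrable_gap hs k, ?_⟩, fun i l => ?_⟩⟩
    · have e : 2 / (μ * α / 2) = 4 * (1 / (μ * α)) := by
        field_simp
        norm_num
      have h2 : 2 / (μ * α / 2) * Real.log (1 / ε) ≤ 4 * (388 * Q) * Real.log (1 / ε) := by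
        rw [e]
        gcongr
      have h3 : 1 ≤ Q * Real.log (1 / ε) := one_le_mul_of_one_le_of_one_le hQ1 hlog
      linarith
    · have h2 := hk k hkN
      have h3 : 0 ≤ 4 * n * K * (1 - μ * α / 2) ^ k := by
        have := sub_pos.2 hβ1
        positivity
      linarith [(hle k).1]
    · have h2 := hk k hkN
      have h3 : 0 ≤ K * (1 - μ * α / 2) ^ k := by
        have := sub_pos.2 hβ1
        positivity
      obtain ⟨hint, h4⟩ := integral_iter_sub_iter_le (f := f) (W := W) (α := α) (x0 := x0) hs k i l
      refine ⟨hint, h4.trans ?_⟩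
      have h5 := mul_le_mul_of_nonneg_left (hle k).2.1 (by positivity : (0 : ℝ) ≤ 4 * n)
      linarith
  · rw [iter, (netState_eq_centralSAGA hW hl α x0 _ _ k).1]
  · refine max_eq_left ?_
    have h2 : (m : ℝ) ≤ Qopt n m (L / μ) := (le_max_right _ _).trans (le_max_right _ _)
    have h3 : Qnet n (L / μ) (secondSV W) = 1 := by
      rw [Qnet, hl]
      norm_num
    rw [h3]
    exact hm1.trans h2
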